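/- **Theorem (TVD and entropy diminishing).** Let $f:\mathbb R\to\mathbb R$ be $C^1$ and strictly convex or strictly concave on an interval $I$, and consider $u_t+f(u)_x=0$. Put $a(u,v)=\dfrac{[f'(w)w-f(w)]_u^v}{[f'(w)]_u^v}$ for $u\ne v$, and $a(u,u)=u$. A finite list of particles $(x_i,u_i)$, $x_1\le\dots\le x_N$, represents the function $u$ that equals $u_1$ for $x<x_1$, equals $u_N$ for $x\ge x_N$, and on $[x_i,x_{i+1})$ with $x_i<x_{i+1}$ is the similarity wave given by $$x(v)=x_i+\frac{f'(v)-f'(u_i)}{f'(u_{i+1})-f'(u_i)}\,(x_{i+1}-x_i),\qquad v \text{ between } u_i \text{ and } u_{i+1}$$ (the constant $u_i$ if $u_i=u_{i+1}$). Initially there is at least one particle, at most two particles share a position (a jump), and all $u_i\in I$. A run of the *particle method* consists of times $0=t_0\le t_1\le t_2\le\dots$ such that during $[t_n,t_{n+1}]$ the particles move by $\dot x_i=f'(u_i)$, $\dot u_i=0$, without overtaking each other, and at $t_{n+1}$ finitely many of the following operations are performed on neighbouring particles. * *Insertion* of $(x_{23},u_{23})$, $x_2<x_{23}<x_3$, $u_{23}\in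 I$, with $(x_{23}-x_2)a(u_2,u_{23})+(x_3-x_{23})a(u_{23},u_3)=(x_3-x_2)a(u_2,u_3)$; or insertion, to the left of the first or to the right of the last particle, of a particle with the same value as that particle. * *Removal*: of more than two particles at one position, all but one with the smallest and one with the largest value are removed. * *Merging*: for $x_1<x_2=x_3<x_4$ and $f'(u_2)>f'(u_3)$, particles 2 and 3 are replaced by $(x_{23},u_{23})$ with $x_{23}=\frac{x_2+x_3}2$, $u_{23}\in I$ and $(x_{23}-x_1)a(u_1,u_{23})+(x_4-x_{23})a(u_{23},u_4)=(x_2-x_1)a(u_1,u_2)+(x_3-x_2)a(u_2,u_3)+(x_4-x_3)a(u_3,u_4)$. By the *entropy fix*, the merge is carried out only if $u_1\ge u_{23}\ge u_4$ (for $f$ convex), respectively $u_1\le u_{23}\le u_4$ (for $f$ concave); otherwise particles are first inserted next to the shock. Let $u$ be the solution produced by any such run; at a time $t_n$ the solution before and the solution after each operation are both considered. Let $u_L,u_R$ be its constant values near $-\infty$ and $+\infty$. Then: 1. (TVD) The total variation of $u(\cdot,t)$ on $\mathbb R$ is finite and non-increasing, both in time and under every operation. 2. (Entropy condition) Let $\eta:\mathbb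 R\to\mathbb R$ be any convex entropy and $q$ its flux, $q(v)-q(u)=\int_u^v\eta'f'\,dw$ (in particular any Kružkov pair $\eta(u)=|u-k|$, $q(u)=\operatorname{sign}(u-k)(f(u)-f(k))$). (a) During particle movement, $\eta(u)_t+q(u)_x\le 0$ holds in the sense of distributions on each strip $(t_n,t_{n+1})\times\mathbb R$. (b) Across any number of movements and operations it holds integrated in space: for $s\le t$, $$\int_{\mathbb R}\bigl(\eta(u(x,t))-\eta(u(x,s))\bigr)\,dx+(t-s)\bigl(q(u_R)-q(u_L)\bigr)\le 0 .$$ In particular no operation at a fixed time increases the total entropy $\int\eta(u)\,dx$. 3. (No spurious oscillations) If $u(\cdot,s)$ takes values in $[\alpha,\beta]$, so does every later $u(\cdot,t)$; if $u(\cdot,s)$ is non-decreasing (non-increasing), so is every later $u(\cdot,t)$. -/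

import Mathlib

open MeasureTheory Set
open scoped ContDiff

namespace ParticleMethod

/-- A particle: a position together with the function value that it carries. -/
@[ext]
structure Particle where
  pos : ℝ
  val : ℝ

/-- The nonlinear average `a(u, v) = [f'(w) w - f(w)]_u^v / [f'(w)]_u^v`, extended by
`a(u, u) = u`. -/
noncomputable def nonlinAverage (f : ℝ → ℝ) (u v : ℝ) : ℝ :=
  if u = v then u
  else ((deriv f v * v - f v) - (deriv f u * u - f u)) / (deriv f v - deriv f u)

/-- The similarity wave between the particles `p` and `q` (`p.pos < q.pos`), evaluated at a
position `x` between them: the value `v` between `p.val` and `q.val` with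
`x = p.pos + (f'(v) - f'(p.val)) / (f'(q.val) - f'(p.val)) * (q.pos - p.pos)`. The equation is
written without denominators so that it also yields the constant interpolant when
`p.val = q.val`. If `f'` is continuous and strictly monotone between the two values, the set
below is a singleton. -/
noncomputable def wave (f : ℝ → ℝ) (p q : Particle) (x : ℝ) : ℝ :=
  sInf {v | v ∈ uIcc p.val q.val ∧
    (x - p.pos) * (deriv f q.val - deriv f p.val) =
      (deriv f v - deriv f p.val) * (q.pos - p.pos)}

/-- The function represented by a list of particles that is ordered from left to right: similarity
waves between neighbouring particles, constant to the left of the first particle and to the right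
of the last one. Several particles at one position represent a jump, at which the right-continuous
representative is taken. -/
noncomputable def interpolant (f : ℝ → ℝ) : List Particle → ℝ → ℝ
  | [], _ => 0
  | [p], _ => p.val
  | p :: q :: l, x =>
    if x < p.pos then p.val
    else if x < q.pos then wave f p q x
    else interpolant f (q :: l) x

/-- Characteristic movement for a time `s`: `x ↦ x + f'(u) s`, `u ↦ u`. -/
noncomputable def move (f : ℝ → ℝ) (s : ℝ) (c : List Particle) : List Particle :=
  c.map fun p => ⟨p.pos + deriv f p.val * s, p.val⟩

/-- The positions of the particles are ordered (particles may share a position). -/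
def Ordered (c : List Particle) : Prop :=
  c.Pairwise fun p q => p.pos ≤ q.pos

/-- One operation of the particle management, for the flux `f` and the interval `I` of
considered function values. -/
inductive Manage (f : ℝ → ℝ) (I : Set ℝ) : List Particle → List Particle → Prop
  /-- Insertion of a particle into a gap, conserving area. -/
  | insert (l r : List Particle) (p q new : Particle)
      (hp : p.pos < new.pos) (hq : new.pos < q.pos) (hval : new.val ∈ I)
      (area : (new.pos - p.pos) * nonlinAverage f p.val new.val
          + (q.pos - new.pos) * nonlinAverage f new.val q.val
        = (q.pos - p.pos) * nonlinAverage f p.val q.val) :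
      Manage f I (l ++ p :: q :: r) (l ++ p :: new :: q :: r)
  /-- Insertion of a particle into the constant state on the left. -/
  | insertLeft (r : List Particle) (q new : Particle)
      (hq : new.pos < q.pos) (hval : new.val = q.val) :
      Manage f I (q :: r) (new :: q :: r)
  /-- Insertion of a particle into the constant state on the right. -/
  | insertRight (l : List Particle) (p new : Particle)
      (hp : p.pos < new.pos) (hval : new.val = p.val) :
      Manage f I (l ++ [p]) (l ++ [p, new])
  /-- Of more than two particles at one position, all but one with the smallest value and one with
  the largest value are removed. -/
  | discard (l r cluster : List Particle) (p q : Particle)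
      (hcard : 2 < cluster.length) (hpos : ∀ c ∈ cluster, c.pos = p.pos)
      (hsub : List.Sublist [p, q] cluster)
      (hval : ∀ c ∈ cluster, c.val ∈ uIcc p.val q.val) :
      Manage f I (l ++ cluster ++ r) (l ++ [p, q] ++ r)
  /-- Merging of two collided particles `p₂`, `p₃` into one, conserving area. The merge is carried
  out only if it passes the test of the entropy fix, `u₁ ≥ u₂₃ ≥ u₄` for convex `f` and
  `u₁ ≤ u₂₃ ≤ u₄` for concave `f`, that is `f'(u₁) ≥ f'(u₂₃) ≥ f'(u₄)`. (If the test fails, the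
  method inserts particles next to the shock and tries again.) -/
  | merge (l r : List Particle) (p₁ p₂ p₃ p₄ new : Particle)
      (h₁₂ : p₁.pos < p₂.pos) (h₂₃ : p₂.pos = p₃.pos) (h₃₄ : p₃.pos < p₄.pos)
      (collide : deriv f p₃.val < deriv f p₂.val)
      (hpos : new.pos = (p₂.pos + p₃.pos) / 2) (hval : new.val ∈ I)
      (area : (new.pos - p₁.pos) * nonlinAverage f p₁.val new.val
          + (p₄.pos - new.pos) * nonlinAverage f new.val p₄.val
        = (p₂.pos - p₁.pos) * nonlinAverage f p₁.val p₂.val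
          + (p₃.pos - p₂.pos) * nonlinAverage f p₂.val p₃.val
          + (p₄.pos - p₃.pos) * nonlinAverage f p₃.val p₄.val)
      (accept₁ : deriv f new.val ≤ deriv f p₁.val)
      (accept₄ : deriv f p₄.val ≤ deriv f new.val) :
      Manage f I (l ++ p₁ :: p₂ :: p₃ :: p₄ :: r) (l ++ p₁ :: new :: p₄ :: r)

/-- A run of the particle method. During phase `n`, that is for times in
`[time n, time (n + 1)]`, the particles `config n` move along characteristics, without overtaking
one another; at `time (n + 1)` finitely many management operations produce `config (n + 1)`.
Phases may have length zero. In the initial data each jump is represented by two particles at the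
same position. -/
structure Run (f : ℝ → ℝ) (I : Set ℝ) where
  time : ℕ → ℝ
  config : ℕ → List Particle
  time_zero : time 0 = 0
  time_mono : Monotone time
  init_ne_nil : config 0 ≠ []
  init_ordered : Ordered (config 0)
  init_jumps : ∀ x : ℝ, ((config 0).map Particle.pos).count x ≤ 2
  init_val : ∀ p ∈ config 0, p.val ∈ I
  no_overtaking : ∀ n, ∀ t ∈ Icc (time n) (time (n + 1)), Ordered (move f (t - time n) (config n))
  management : ∀ n, Relation.ReflTransGen (Manage f I)
    (move f (time (n + 1) - time n) (config n)) (config (n + 1))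

namespace Run

variable {f : ℝ → ℝ} {I : Set ℝ}

/-- The numerical solution `x ↦ u(x, t)` at a time `t` of phase `n`. At a management time,
consecutive phases give the solution before and after the management. -/
noncomputable def solution (R : Run f I) (n : ℕ) (t x : ℝ) : ℝ :=
  interpolant f (move f (t - R.time n) (R.config n)) x

/-- The total variation on the real line of the numerical solution at time `t` of phase `n`. -/
noncomputable def totalVariation (R : Run f I) (n : ℕ) (t : ℝ) : ENNReal :=
  eVariationOn (R.solution n t) univ

/-- The constant state at `-∞`. -/
def leftState (R : Run f I) : ℝ := ((R.config 0).head R.init_ne_nil).val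

/-- The constant state at `+∞`. -/
def rightState (R : Run f I) : ℝ := ((R.config 0).getLast R.init_ne_nil).val

/-- Time `s` of phase `n` is not after time `t` of phase `m`. -/
def Before (R : Run f I) (n : ℕ) (s : ℝ) (m : ℕ) (t : ℝ) : Prop :=
  s ∈ Icc (R.time n) (R.time (n + 1)) ∧ t ∈ Icc (R.time m) (R.time (m + 1)) ∧ n ≤ m ∧ s ≤ t

end Run

/-- `η` is a convex entropy function and `q` an entropy flux for it, `q' = η' f'`. The relation is
integrated since `η` need not be differentiable at every point; thus the Kruzkov pairs
`η(u) = |u - k|`, `q(u) = sign(u - k) (f(u) - f(k))` are included. -/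
def IsEntropyPair (f η q : ℝ → ℝ) : Prop :=
  ConvexOn ℝ univ η ∧ ∀ u v : ℝ, q v - q u = ∫ w in u..v, deriv η w * deriv f w

/-- The entropy inequality `η(u)_t + q(u)_x ≤ 0` in the sense of distributions in the strip
`a < t < b`; the first coordinate is time, the second one is space. -/
def EntropyInequality (η q : ℝ → ℝ) (a b : ℝ) (u : ℝ → ℝ → ℝ) : Prop :=
  ∀ φ : ℝ × ℝ → ℝ, ContDiff ℝ ∞ φ → HasCompactSupport φ → tsupport φ ⊆ Ioo a b ×ˢ univ →
    (∀ z, 0 ≤ φ z) →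
    Integrable (fun z : ℝ × ℝ =>
      η (u z.1 z.2) * fderiv ℝ φ z (1, 0) + q (u z.1 z.2) * fderiv ℝ φ z (0, 1)) ∧
    0 ≤ ∫ z : ℝ × ℝ,
      (η (u z.1 z.2) * fderiv ℝ φ z (1, 0) + q (u z.1 z.2) * fderiv ℝ φ z (0, 1))

end ParticleMethod

/-! Let `P = f' η - q` be the potential of an entropy pair, so that `dP = η d(f')`. On a similarity
wave `f'(u)` is affine in `x`. Hence the integral of `η(u)` over a gap is the width of the gap times
`ΔP / Δf'`, and the total entropy is an explicit function of the particles (`integral_wave`,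
`State.integral_sub`). For `η = id`, `q = f` it is the area, and `ΔP / Δf'` is `a(u, v)`.

Movement widens each gap at the rate `Δf'`, so each wave gains entropy at the rate `ΔP`. Together
with the constant outer states this telescopes to `q(u_L) - q(u_R)`: the integrated balance is an
equality (`State.totalEntropy_move`). Locally, no jump survives inside a phase (`seamless_move`),
and `u` is continuous and constant along characteristics. It need not be differentiable, but there
is `Φ` with `Φ_x = η(u)` and `Φ_t = -q(u)`; symmetry of the second derivatives of the test function
then gives the distributional balance, again with equality.

Strict monotonicity of `a` (`nonlinAverage_lt`) makes the area equations rigid: an inserted particle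
lies on the wave, and a merged value lies between `u₂` and `u₃`. Insertion and removal therefore
leave `u` unchanged. A merge moves every `u(x)` towards the one number `u₂₃`, thanks to the entropy
fix (`interpolant_merge`), and preserves area. With a subgradient `σ` of `η` at `u₂₃`, the change of
`η(u)` is at most `σ` times the change of `u`, whose integral vanishes
(`State.totalEntropy_manage_le`).

On admissible lists the total variation is the sum of the `|Δu_i|`. Movement keeps this sum, and a
merge does not increase it because `u₂₃` lies between `u₁` and `u₄`. Admissibility excludes
variation hidden in a cluster of particles, which could reappear later; it persists because
colliding particles are ordered by non-increasing speed. A profile is monotone exactly when its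
variation does not exceed the difference of its end states, so monotonicity is inherited from the
variation bound. -/

namespace ParticleMethod

/-! ### Genuinely nonlinear fluxes and their nonlinear averages. -/

/-- `f` is `C¹` and strictly convex or strictly concave on `I`. -/
structure GenuinelyNonlinear (f : ℝ → ℝ) (I : Set ℝ) : Prop where
  contDiff : ContDiff ℝ 1 f
  convex_or_concave : StrictConvexOn ℝ I f ∨ StrictConcaveOn ℝ I f

namespace GenuinelyNonlinear

variable {f : ℝ → ℝ} {I : Set ℝ}

theorem differentiable (H : GenuinelyNonlinear f I) : Differentiable ℝ f :=
  H.contDiff.differentiable (by norm_num)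

theorem continuous_deriv (H : GenuinelyNonlinear f I) : Continuous (deriv f) :=
  H.contDiff.continuous_deriv le_rfl

theorem neg (H : GenuinelyNonlinear f I) : GenuinelyNonlinear (fun x => -f x) I :=
  ⟨H.contDiff.neg, H.convex_or_concave.symm.imp (fun h => h.neg) (fun h => h.neg)⟩

theorem ordConnected (H : GenuinelyNonlinear f I) : I.OrdConnected :=
  H.convex_or_concave.elim (fun h => h.1.ordConnected) (fun h => h.1.ordConnected)

theorem strictMonoOn_or (H : GenuinelyNonlinear f I) :
    StrictMonoOn (deriv f) I ∨ StrictAntiOn (deriv f) I :=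
  H.convex_or_concave.imp (fun h => h.strictMonoOn_deriv fun x _ => H.differentiable x)
    (fun h => h.strictAntiOn_deriv fun x _ => H.differentiable x)

theorem injOn (H : GenuinelyNonlinear f I) : InjOn (deriv f) I :=
  H.strictMonoOn_or.elim (fun h => h.injOn) (fun h => h.injOn)

theorem uIcc_subset (H : GenuinelyNonlinear f I) {u v : ℝ} (hu : u ∈ I) (hv : v ∈ I) :
    uIcc u v ⊆ I :=
  H.ordConnected.uIcc_subset hu hv

theorem mem_uIcc_of_deriv_mem (H : GenuinelyNonlinear f I) {u v w : ℝ} (hu : u ∈ I) (hv : v ∈ I)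
    (hw : w ∈ I) (h : deriv f w ∈ uIcc (deriv f u) (deriv f v)) : w ∈ uIcc u v := by
  rw [mem_uIcc] at h ⊢
  rcases H.strictMonoOn_or with m | m
  · rwa [m.le_iff_le hu hw, m.le_iff_le hw hv, m.le_iff_le hv hw, m.le_iff_le hw hu] at h
  · rw [m.le_iff_ge hu hw, m.le_iff_ge hw hv, m.le_iff_ge hv hw, m.le_iff_ge hw hu] at h
    tauto

theorem deriv_mem_uIcc (H : GenuinelyNonlinear f I) {u v w : ℝ} (hu : u ∈ I) (hv : v ∈ I)
    (hw : w ∈ uIcc u v) : deriv f w ∈ uIcc (deriv f u) (deriv f v) := by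
  have hwI := H.uIcc_subset hu hv hw
  rw [mem_uIcc] at hw ⊢
  rcases H.strictMonoOn_or with m | m
  · rwa [m.le_iff_le hu hwI, m.le_iff_le hwI hv, m.le_iff_le hv hwI, m.le_iff_le hwI hu]
  · rw [m.le_iff_ge hu hwI, m.le_iff_ge hwI hv, m.le_iff_ge hv hwI, m.le_iff_ge hwI hu]
    tauto

end GenuinelyNonlinear

/-- The entropy potential `f' η - q`, whose differential is `η d(f')`. -/
noncomputable def potential (f η q : ℝ → ℝ) (v : ℝ) : ℝ := deriv f v * η v - q v

/-- The average of `η` over the similarity wave between the values `u` and `v`. -/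
noncomputable def waveAverage (f η q : ℝ → ℝ) (u v : ℝ) : ℝ :=
  if u = v then η u
  else (potential f η q v - potential f η q u) / (deriv f v - deriv f u)

theorem nonlinAverage_eq_waveAverage (f : ℝ → ℝ) (u v : ℝ) :
    nonlinAverage f u v = waveAverage f id f u v := rfl

theorem nonlinAverage_comm (f : ℝ → ℝ) (u v : ℝ) : nonlinAverage f u v = nonlinAverage f v u := by
  unfold nonlinAverage
  by_cases h : u = v
  · simp [h]
  · rw [if_neg h, if_neg (Ne.symm h), ← neg_div_neg_eq]
    congr 1 <;> ring

theorem nonlinAverage_neg (f : ℝ → ℝ) (u v : ℝ) :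
    nonlinAverage (fun x => -f x) u v = nonlinAverage f u v := by
  have h : ∀ w, deriv (fun x => -f x) w = -deriv f w := fun w => deriv.fun_neg
  unfold nonlinAverage
  rw [h, h, ← neg_div_neg_eq]
  split_ifs
  · rfl
  · congr 1 <;> ring

namespace GenuinelyNonlinear

variable {f : ℝ → ℝ} {I : Set ℝ}

/-- Free of division and therefore valid for `u = v` as well; in this form sums over neighbouring
waves telescope. -/
theorem waveAverage_mul (H : GenuinelyNonlinear f I) (η q : ℝ → ℝ) {u v : ℝ} (hu : u ∈ I)
    (hv : v ∈ I) : waveAverage f η q u v * (deriv f v - deriv f u)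
      = potential f η q v - potential f η q u := by
  unfold waveAverage
  split_ifs with h
  · simp [h]
  · have : deriv f v - deriv f u ≠ 0 := fun h0 => h (H.injOn hu hv (sub_eq_zero.1 h0).symm)
    field_simp

theorem nonlinAverage_mem_Ioo (H : GenuinelyNonlinear f I) {u v : ℝ} (hu : u ∈ I) (hv : v ∈ I)
    (huv : u < v) : nonlinAverage f u v ∈ Ioo u v := by
  -- The average is invariant under `f ↦ -f`, so the convex case suffices; there the bounds are the
  -- tangent inequalities at the two endpoints.
  wlog hc : StrictConvexOn ℝ I f generalizing f
  · have := this H.neg ((H.convex_or_concave.resolve_left hc).neg)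
    rwa [nonlinAverage_neg] at this
  have h1 := hc.deriv_lt_slope hu hv huv (H.differentiable u)
  have h2 := hc.slope_lt_deriv hu hv huv (H.differentiable v)
  have h3 : 0 < v - u := sub_pos.2 huv
  rw [slope_def_field, lt_div_iff₀ h3] at h1
  rw [slope_def_field, div_lt_iff₀ h3] at h2
  have h4 : 0 < deriv f v - deriv f u := by nlinarith
  unfold nonlinAverage
  rw [if_neg huv.ne]
  constructor
  · rw [lt_div_iff₀ h4]; nlinarith
  · rw [div_lt_iff₀ h4]; nlinarith

/-- The potential telescopes: for `v` between `u` and `w`, `a(u, w)` is the mean of `a(u, v)` and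
`a(v, w)` weighted by the increments of `f'`. -/
theorem nonlinAverage_add (H : GenuinelyNonlinear f I) {u v w : ℝ} (hu : u ∈ I)
    (hv : v ∈ I) (hw : w ∈ I) : nonlinAverage f u w * (deriv f w - deriv f u)
      = nonlinAverage f u v * (deriv f v - deriv f u)
        + nonlinAverage f v w * (deriv f w - deriv f v) := by
  simp only [nonlinAverage_eq_waveAverage, H.waveAverage_mul id f hu hw,
    H.waveAverage_mul id f hu hv, H.waveAverage_mul id f hv hw]
  ring

theorem nonlinAverage_self (u : ℝ) : nonlinAverage f u u = u := by simp [nonlinAverage]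

/-- If `u` lies between `v` and `w`, it separates the two averages. Otherwise one of them is a
weighted mean of the other and `a(v, w)`, and these two are separated by `v` or by `w`. This
monotonicity is what makes the area equations uniquely solvable. -/
theorem nonlinAverage_lt (H : GenuinelyNonlinear f I) {u v w : ℝ} (hu : u ∈ I)
    (hv : v ∈ I) (hw : w ∈ I) (hvw : v < w) : nonlinAverage f u v < nonlinAverage f u w := by
  wlog hc : StrictConvexOn ℝ I f generalizing f
  · have := this H.neg ((H.convex_or_concave.resolve_left hc).neg)
    rwa [nonlinAverage_neg, nonlinAverage_neg] at this
  have m := hc.strictMonoOn_deriv fun x _ => H.differentiable x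
  have hA := H.nonlinAverage_add hu hv hw
  have b := H.nonlinAverage_mem_Ioo hv hw hvw
  have gvw := m hv hw hvw
  rcases lt_trichotomy u v with h | h | h
  · have a := H.nonlinAverage_mem_Ioo hu hv h
    have guv := m hu hv h
    have : nonlinAverage f u v < nonlinAverage f v w := a.2.trans b.1
    by_contra! hle
    nlinarith
  · subst h; rw [nonlinAverage_self]; exact b.1
  · rcases lt_trichotomy u w with h' | h' | h'
    · rw [nonlinAverage_comm f u v]
      exact (H.nonlinAverage_mem_Ioo hv hu h).2.trans (H.nonlinAverage_mem_Ioo hu hw h').1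
    · subst h'; rw [nonlinAverage_self, nonlinAverage_comm]; exact b.2
    · have a := H.nonlinAverage_mem_Ioo hw hu h'
      rw [nonlinAverage_comm] at a
      have guw := m hw hu h'
      have : nonlinAverage f v w < nonlinAverage f u w := b.2.trans a.1
      by_contra! hle
      nlinarith

end GenuinelyNonlinear

/-! ### Entropy pairs and the regularity of their potentials. -/

namespace IsEntropyPair

variable {f η q : ℝ → ℝ} {I : Set ℝ}

theorem continuous (h : IsEntropyPair f η q) : Continuous η :=
  h.1.locallyLipschitz.continuous

theorem exists_lipschitzOnWith (h : IsEntropyPair f η q) (a b : ℝ) :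
    ∃ K, LipschitzOnWith K η (Icc a b) :=
  (h.1.locallyLipschitz.locallyLipschitzOn).exists_lipschitzOnWith_of_compact isCompact_Icc

/-- A convex function is locally Lipschitz, hence absolutely continuous on bounded intervals, so
kinks of `η` do no harm. -/
theorem integral_deriv (h : IsEntropyPair f η q) (u v : ℝ) :
    ∫ w in u..v, deriv η w = η v - η u := by
  obtain ⟨K, hK⟩ := h.exists_lipschitzOnWith (min u v) (max u v)
  exact AbsolutelyContinuousOnInterval.integral_deriv_eq_sub
    (LipschitzOnWith.absolutelyContinuousOnInterval hK)

theorem intervalIntegrable_deriv (h : IsEntropyPair f η q) (u v : ℝ) :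
    IntervalIntegrable (deriv η) volume u v := by
  obtain ⟨K, hK⟩ := h.exists_lipschitzOnWith (min u v) (max u v)
  exact AbsolutelyContinuousOnInterval.intervalIntegrable_deriv
    (LipschitzOnWith.absolutelyContinuousOnInterval hK)

theorem intervalIntegrable_mul (h : IsEntropyPair f η q) (H : GenuinelyNonlinear f I) (u v : ℝ) :
    IntervalIntegrable (fun w => deriv η w * deriv f w) volume u v :=
  (h.intervalIntegrable_deriv u v).mul_continuousOn H.continuous_deriv.continuousOn

theorem continuous_flux (h : IsEntropyPair f η q) (H : GenuinelyNonlinear f I) : Continuous q := by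
  have : q = fun v => q 0 + ∫ w in (0:ℝ)..v, deriv η w * deriv f w := by
    funext v; rw [← h.2]; ring
  rw [this]
  exact continuous_const.add
    (intervalIntegral.continuous_primitive (h.intervalIntegrable_mul H) 0)

theorem continuous_potential (h : IsEntropyPair f η q) (H : GenuinelyNonlinear f I) :
    Continuous (potential f η q) :=
  (H.continuous_deriv.mul h.continuous).sub (h.continuous_flux H)

/-- Integration by parts in `∫ η d(f')`. As `f'` is merely continuous, the derivative has to fall on
`η`. -/
theorem potential_sub (h : IsEntropyPair f η q) (H : GenuinelyNonlinear f I) (u v : ℝ) :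
    potential f η q v - potential f η q u - η v * (deriv f v - deriv f u)
      = ∫ w in u..v, deriv η w * (deriv f u - deriv f w) := by
  simp only [mul_sub]
  rw [intervalIntegral.integral_sub ((h.intervalIntegrable_deriv u v).mul_const _)
    (h.intervalIntegrable_mul H u v), intervalIntegral.integral_mul_const, h.integral_deriv, ← h.2]
  unfold potential
  ring

/-- Quantitative form of `dP = η d(f')`: the error carries the factor `|Δf'|` and in addition the
small factor `|v - u|`. -/
theorem exists_abs_potential_sub_le (h : IsEntropyPair f η q) (H : GenuinelyNonlinear f I)
    (a b : ℝ) : ∃ L, ∀ u ∈ I ∩ Icc a b, ∀ v ∈ I ∩ Icc a b,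
      |potential f η q v - potential f η q u - η v * (deriv f v - deriv f u)|
        ≤ L * |deriv f v - deriv f u| * |v - u| := by
  -- The margin 1 makes every point of `[a, b]` interior, so that the Lipschitz constant bounds `η'`
  -- there.
  obtain ⟨K, hK⟩ := h.exists_lipschitzOnWith (a - 1) (b + 1)
  refine ⟨K, fun u hu v hv => ?_⟩
  rw [h.potential_sub H]
  rw [← Real.norm_eq_abs (∫ w in u..v, _)]
  refine intervalIntegral.norm_integral_le_of_norm_le_const fun w hw => ?_
  have hw' := uIoc_subset_uIcc hw
  have hwab : w ∈ Icc a b := ordConnected_Icc.uIcc_subset hu.2 hv.2 hw'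
  rw [norm_mul]
  gcongr
  · refine norm_deriv_le_of_lipschitzOn (Icc_mem_nhds ?_ ?_) hK
    · linarith [hwab.1]
    · linarith [hwab.2]
  · have := H.deriv_mem_uIcc hu.1 hv.1 hw'
    rw [Real.norm_eq_abs, abs_sub_comm]
    exact abs_sub_left_of_mem_uIcc this

end IsEntropyPair

/-- Area is the total entropy for `η = id`, so every entropy formula below also serves to compute
areas. -/
theorem GenuinelyNonlinear.isEntropyPair_id {f : ℝ → ℝ} {I : Set ℝ} (H : GenuinelyNonlinear f I) :
    IsEntropyPair f id f := by
  refine ⟨convexOn_id convex_univ, fun u v => ?_⟩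
  simp only [deriv_id', one_mul]
  exact (intervalIntegral.integral_deriv_eq_sub (fun x _ => H.differentiable x)
    (H.continuous_deriv.intervalIntegrable _ _)).symm

end ParticleMethod

/-! ### Similarity waves. -/

namespace ParticleMethod

section Wave

variable {f : ℝ → ℝ} {I : Set ℝ} {p q : Particle} {x y : ℝ}

namespace GenuinelyNonlinear

theorem wave_eq (H : GenuinelyNonlinear f I) (hp : p.val ∈ I) (hq : q.val ∈ I)
    (hpq : p.pos < q.pos) {v : ℝ} (hv : v ∈ uIcc p.val q.val)
    (h : (x - p.pos) * (deriv f q.val - deriv f p.val)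
      = (deriv f v - deriv f p.val) * (q.pos - p.pos)) : wave f p q x = v := by
  have : {v | v ∈ uIcc p.val q.val ∧ (x - p.pos) * (deriv f q.val - deriv f p.val) =
      (deriv f v - deriv f p.val) * (q.pos - p.pos)} = {v} := by
    refine Subset.antisymm (fun w hw => ?_) (singleton_subset_iff.2 ⟨hv, h⟩)
    have h0 : q.pos - p.pos ≠ 0 := (sub_pos.2 hpq).ne'
    have h1 := mul_right_cancel₀ h0 (hw.2.symm.trans h)
    exact H.injOn (H.uIcc_subset hp hq hw.1) (H.uIcc_subset hp hq hv) (by linarith)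
  rw [wave, this, csInf_singleton]

theorem wave_spec (H : GenuinelyNonlinear f I) (hp : p.val ∈ I) (hq : q.val ∈ I)
    (hpq : p.pos < q.pos) (hx : x ∈ Icc p.pos q.pos) :
    wave f p q x ∈ uIcc p.val q.val ∧ (x - p.pos) * (deriv f q.val - deriv f p.val)
      = (deriv f (wave f p q x) - deriv f p.val) * (q.pos - p.pos) := by
  have h0 : 0 < q.pos - p.pos := sub_pos.2 hpq
  have hmem : deriv f p.val + (x - p.pos) / (q.pos - p.pos) * (deriv f q.val - deriv f p.val)
      ∈ uIcc (deriv f p.val) (deriv f q.val) := by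
    have h1 : 0 ≤ (x - p.pos) / (q.pos - p.pos) := div_nonneg (by linarith [hx.1]) h0.le
    have h2 : (x - p.pos) / (q.pos - p.pos) ≤ 1 := by rw [div_le_one h0]; linarith [hx.2]
    rw [mem_uIcc]
    rcases le_total (deriv f p.val) (deriv f q.val) with h | h
    · left; constructor <;> nlinarith
    · right; constructor <;> nlinarith
  obtain ⟨v, hv, hgv⟩ := intermediate_value_uIcc H.continuous_deriv.continuousOn hmem
  have he : (x - p.pos) * (deriv f q.val - deriv f p.val)
      = (deriv f v - deriv f p.val) * (q.pos - p.pos) := by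
    rw [hgv]; field_simp; ring
  rw [H.wave_eq hp hq hpq hv he]
  exact ⟨hv, he⟩

theorem wave_left (H : GenuinelyNonlinear f I) (hp : p.val ∈ I) (hq : q.val ∈ I)
    (hpq : p.pos < q.pos) : wave f p q p.pos = p.val :=
  H.wave_eq hp hq hpq left_mem_uIcc (by ring)

theorem wave_right (H : GenuinelyNonlinear f I) (hp : p.val ∈ I) (hq : q.val ∈ I)
    (hpq : p.pos < q.pos) : wave f p q q.pos = q.val :=
  H.wave_eq hp hq hpq right_mem_uIcc (by ring)

theorem wave_mem (H : GenuinelyNonlinear f I) (hp : p.val ∈ I) (hq : q.val ∈ I)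
    (hpq : p.pos < q.pos) (hx : x ∈ Icc p.pos q.pos) : wave f p q x ∈ I :=
  H.uIcc_subset hp hq (H.wave_spec hp hq hpq hx).1

theorem deriv_wave (H : GenuinelyNonlinear f I) (hp : p.val ∈ I) (hq : q.val ∈ I)
    (hpq : p.pos < q.pos) (hx : x ∈ Icc p.pos q.pos) : deriv f (wave f p q x)
      = deriv f p.val
        + (x - p.pos) * ((deriv f q.val - deriv f p.val) / (q.pos - p.pos)) := by
  have h0 : q.pos - p.pos ≠ 0 := (sub_pos.2 hpq).ne'
  have := (H.wave_spec hp hq hpq hx).2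
  field_simp
  linarith

theorem wave_mem_uIcc_wave (H : GenuinelyNonlinear f I) (hp : p.val ∈ I) (hq : q.val ∈ I)
    (hpq : p.pos < q.pos) (hx : p.pos ≤ x) (hxy : x ≤ y) (hy : y ≤ q.pos) :
    wave f p q x ∈ uIcc p.val (wave f p q y) := by
  have hx' : x ∈ Icc p.pos q.pos := ⟨hx, hxy.trans hy⟩
  have hy' : y ∈ Icc p.pos q.pos := ⟨hx.trans hxy, hy⟩
  refine H.mem_uIcc_of_deriv_mem hp (H.wave_mem hp hq hpq hy') (H.wave_mem hp hq hpq hx') ?_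
  rw [H.deriv_wave hp hq hpq hx', H.deriv_wave hp hq hpq hy', mem_uIcc]
  rcases le_total 0 ((deriv f q.val - deriv f p.val) / (q.pos - p.pos)) with h | h
  · left; constructor <;> nlinarith
  · right; constructor <;> nlinarith

/-- The wave is an affine function followed by the inverse of `f'`. That inverse is continuous
because `f'` is injective and continuous on a compact interval. -/
theorem continuousOn_wave (H : GenuinelyNonlinear f I) (hp : p.val ∈ I) (hq : q.val ∈ I)
    (hpq : p.pos < q.pos) : ContinuousOn (wave f p q) (Icc p.pos q.pos) := by
  have hemb : Topology.IsClosedEmbedding ((uIcc p.val q.val).domRestrict (deriv f)) :=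
    haveI : CompactSpace (uIcc p.val q.val) := isCompact_iff_compactSpace.1 isCompact_uIcc
    (H.continuous_deriv.continuousOn.domRestrict).isClosedEmbedding
      (injOn_iff_injective.1 (H.injOn.mono (H.uIcc_subset hp hq)))
  rw [continuousOn_iff_continuous_domRestrict]
  let w : Icc p.pos q.pos → uIcc p.val q.val :=
    fun x => ⟨wave f p q x, (H.wave_spec hp hq hpq x.2).1⟩
  have hw : Continuous w := by
    rw [hemb.isInducing.continuous_iff]
    have : (uIcc p.val q.val).domRestrict (deriv f) ∘ w = fun x : Icc p.pos q.pos => deriv f p.val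
        + ((x : ℝ) - p.pos) * ((deriv f q.val - deriv f p.val) / (q.pos - p.pos)) :=
      funext fun x => H.deriv_wave hp hq hpq x.2
    rw [this]
    fun_prop
  exact continuous_subtype_val.comp hw

/-- The wave itself need not be differentiable, but `f'` along it has the exact increment `κ Δx`.
The error in `dP = η d(f')` is thus `|Δx|` times a quantity that vanishes by continuity of the wave.
-/
theorem hasDerivAt_potential_wave (H : GenuinelyNonlinear f I) {η θ : ℝ → ℝ}
    (h : IsEntropyPair f η θ) (hp : p.val ∈ I) (hq : q.val ∈ I)
    (hpq : p.pos < q.pos) (hx : x ∈ Ioo p.pos q.pos) :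
    HasDerivAt (fun y => potential f η θ (wave f p q y))
      ((deriv f q.val - deriv f p.val) / (q.pos - p.pos) * η (wave f p q x)) x := by
  set κ := (deriv f q.val - deriv f p.val) / (q.pos - p.pos) with hκ
  obtain ⟨L, hL⟩ := h.exists_abs_potential_sub_le H (min p.val q.val) (max p.val q.val)
  have hx' : x ∈ Icc p.pos q.pos := Ioo_subset_Icc_self hx
  have hnhds : Icc p.pos q.pos ∈ nhds x := Icc_mem_nhds hx.1 hx.2
  have hc : ContinuousAt (wave f p q) x := (H.continuousOn_wave hp hq hpq).continuousAt hnhds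
  rw [hasDerivAt_iff_isLittleO, Asymptotics.isLittleO_iff]
  intro c hc0
  have hlim : Filter.Tendsto (fun y => |κ| * (|L| * |wave f p q y - wave f p q x|
      + |η (wave f p q y) - η (wave f p q x)|)) (nhds x) (nhds 0) := by
    have h1 : ContinuousAt (fun y => |κ| * (|L| * |wave f p q y - wave f p q x|
      + |η (wave f p q y) - η (wave f p q x)|)) x := by
      have hη : ContinuousAt (fun y => η (wave f p q y)) x :=
        ContinuousAt.comp (g := η) h.continuous.continuousAt hc
      exact continuousAt_const.mul ((continuousAt_const.mul (hc.sub continuousAt_const).abs).add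
        (hη.sub continuousAt_const).abs)
    simpa [ContinuousAt] using h1
  filter_upwards [hnhds, hlim.eventually_le_const hc0] with y hy hyc
  have key := hL _ ⟨H.wave_mem hp hq hpq hx', (H.wave_spec hp hq hpq hx').1⟩
    _ ⟨H.wave_mem hp hq hpq hy, (H.wave_spec hp hq hpq hy).1⟩
  have hg : deriv f (wave f p q y) - deriv f (wave f p q x) = (y - x) * κ := by
    rw [H.deriv_wave hp hq hpq hx', H.deriv_wave hp hq hpq hy]; ring
  rw [hg, abs_mul] at key
  rw [Real.norm_eq_abs, Real.norm_eq_abs, smul_eq_mul]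
  calc |potential f η θ (wave f p q y) - potential f η θ (wave f p q x)
        - (y - x) * (κ * η (wave f p q x))|
      = |(potential f η θ (wave f p q y) - potential f η θ (wave f p q x)
        - η (wave f p q y) * ((y - x) * κ))
        + (y - x) * κ * (η (wave f p q y) - η (wave f p q x))| := by congr 1; ring
    _ ≤ L * (|y - x| * |κ|) * |wave f p q y - wave f p q x|
        + |y - x| * |κ| * |η (wave f p q y) - η (wave f p q x)| := by
      refine (abs_add_le _ _).trans (add_le_add key ?_)
      rw [abs_mul, abs_mul]
    _ ≤ |L| * (|y - x| * |κ|) * |wave f p q y - wave f p q x|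
        + |y - x| * |κ| * |η (wave f p q y) - η (wave f p q x)| := by
      gcongr; exact le_abs_self L
    _ = (|κ| * (|L| * |wave f p q y - wave f p q x|
        + |η (wave f p q y) - η (wave f p q x)|)) * |y - x| := by ring
    _ ≤ c * |y - x| := by gcongr

/-- `κ η(u)` is the derivative of the potential along the wave, so the integral is `ΔP / κ`. -/
theorem integral_wave (H : GenuinelyNonlinear f I) {η θ : ℝ → ℝ}
    (h : IsEntropyPair f η θ) (hp : p.val ∈ I) (hq : q.val ∈ I)
    (hpq : p.pos < q.pos) (hx : x ∈ Icc p.pos q.pos) :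
    ∫ y in p.pos..x, η (wave f p q y)
      = (x - p.pos) * waveAverage f η θ p.val (wave f p q x) := by
  have hsub : Icc p.pos x ⊆ Icc p.pos q.pos := Icc_subset_Icc_right hx.2
  -- For equal values `κ = 0` and the potential carries no information; the wave is then constant.
  rcases eq_or_ne p.val q.val with heq | hne
  · have hconst : ∀ y ∈ Icc p.pos q.pos, wave f p q y = p.val := fun y hy => by
      simpa [heq] using (H.wave_spec hp hq hpq hy).1
    rw [intervalIntegral.integral_congr (g := fun _ => η p.val), hconst x hx]
    · simp [waveAverage]
    · intro y hy
      rw [uIcc_of_le hx.1] at hy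
      simp only [hconst y (hsub hy)]
  · have h0 : 0 < q.pos - p.pos := sub_pos.2 hpq
    have hκ : (deriv f q.val - deriv f p.val) / (q.pos - p.pos) ≠ 0 :=
      div_ne_zero (fun h1 => hne (H.injOn hp hq (sub_eq_zero.1 h1).symm)) h0.ne'
    have hcw := (H.continuousOn_wave hp hq hpq).mono hsub
    have hFTC := intervalIntegral.integral_eq_sub_of_hasDerivAt_of_le hx.1
      ((h.continuous_potential H).comp_continuousOn hcw)
      (fun y hy => H.hasDerivAt_potential_wave h hp hq hpq ⟨hy.1, hy.2.trans_le hx.2⟩)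
      ((continuousOn_const.mul (h.continuous.comp_continuousOn hcw)).intervalIntegrable_of_Icc hx.1)
    rw [intervalIntegral.integral_const_mul, Function.comp_apply, Function.comp_apply,
      H.wave_left hp hq hpq, ← H.waveAverage_mul η θ hp (H.wave_mem hp hq hpq hx),
      H.deriv_wave hp hq hpq hx] at hFTC
    refine mul_left_cancel₀ hκ (hFTC.trans ?_)
    ring

end GenuinelyNonlinear

end Wave

end ParticleMethod

/-! ### The represented function, its range and its variation. -/

namespace ParticleMethod

section Interpolant

variable {f : ℝ → ℝ} {I : Set ℝ} {p q : Particle} {l c : List Particle} {x y : ℝ}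

theorem interpolant_of_lt (hx : x < p.pos) : interpolant f (p :: l) x = p.val := by
  cases l with
  | nil => rfl
  | cons q l => simp [interpolant, hx]

theorem interpolant_of_le (hpq : p.pos ≤ q.pos) (hx : q.pos ≤ x) :
    interpolant f (p :: q :: l) x = interpolant f (q :: l) x := by
  simp [interpolant, (hpq.trans hx).not_gt, hx.not_gt]

theorem interpolant_eq_wave (hp : p.pos ≤ x) (hx : x < q.pos) :
    interpolant f (p :: q :: l) x = wave f p q x := by
  simp [interpolant, hp.not_gt, hx]

theorem interpolant_getLast (h : ∀ r ∈ p :: l, r.pos ≤ x) :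
    interpolant f (p :: l) x = ((p :: l).getLast (List.cons_ne_nil p l)).val := by
  induction l generalizing p with
  | nil => rfl
  | cons q l ih =>
    have hp := h p (by simp)
    have hq := h q (by simp)
    rw [List.getLast_cons (List.cons_ne_nil q l), ← ih fun r hr => h r (List.mem_cons_of_mem _ hr)]
    simp [interpolant, hp.not_gt, hq.not_gt]

theorem GenuinelyNonlinear.interpolant_mem (H : GenuinelyNonlinear f I) {S : Set ℝ}
    [hS : S.OrdConnected] (hc : c ≠ []) (hI : ∀ p ∈ c, p.val ∈ I) (h : ∀ p ∈ c, p.val ∈ S)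
    (x : ℝ) : interpolant f c x ∈ S := by
  induction c with
  | nil => exact absurd rfl hc
  | cons p l ih =>
    cases l with
    | nil => exact h p (by simp)
    | cons q l =>
      simp only [interpolant]
      split_ifs with h1 h2
      · exact h p (by simp)
      · have := H.wave_spec (hI p (by simp)) (hI q (by simp)) (by linarith)
          (show x ∈ Icc p.pos q.pos from ⟨not_lt.1 h1, h2.le⟩)
        exact hS.uIcc_subset (h p (by simp)) (h q (by simp)) this.1
      · exact ih (by simp) (fun r hr => hI r (List.mem_cons_of_mem _ hr))
          (fun r hr => h r (List.mem_cons_of_mem _ hr))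

/-- At every position there are either at most two particles, or the characteristic speeds
decrease from left to right. -/
def Clustered (f : ℝ → ℝ) (c : List Particle) : Prop :=
  ∀ y : ℝ, (c.filter fun p => p.pos = y).length ≤ 2 ∨
    (c.filter fun p => p.pos = y).Pairwise fun p q => deriv f q.val ≤ deriv f p.val

/-- A list of particles in `I` that is ordered and whose clusters are compressive or jumps. -/
structure Admissible (f : ℝ → ℝ) (I : Set ℝ) (c : List Particle) : Prop where
  mem : ∀ p ∈ c, p.val ∈ I
  ordered : Ordered c
  clustered : Clustered f c

theorem Clustered.sublist {c' : List Particle} (h : Clustered f c) (hs : c'.Sublist c) :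
    Clustered f c' := fun y =>
  (h y).imp (fun h => (hs.filter _).length_le.trans h) (fun h => h.sublist (hs.filter _))

theorem Admissible.sublist {c' : List Particle} (h : Admissible f I c) (hs : c'.Sublist c) :
    Admissible f I c' :=
  ⟨fun p hp => h.mem p (hs.subset hp), h.ordered.sublist hs, h.clustered.sublist hs⟩

theorem Admissible.tail (h : Admissible f I (p :: l)) : Admissible f I l :=
  h.sublist (List.sublist_cons_self p l)

theorem Admissible.pos_le (h : Admissible f I (p :: l)) (hq : q ∈ l) : p.pos ≤ q.pos :=
  (List.pairwise_cons.1 h.ordered).1 q hq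

/-- By right continuity the value is carried by the last particle `r` of the cluster at `p.pos`. -/
theorem exists_interpolant_head (H : GenuinelyNonlinear f I) (h : Admissible f I (p :: l)) :
    ∃ r, interpolant f (p :: l) p.pos = r.val ∧ r.pos = p.pos ∧ (r = p ∨ r ∈ l) := by
  induction l generalizing p with
  | nil => exact ⟨p, rfl, rfl, Or.inl rfl⟩
  | cons q l ih =>
    rcases (h.pos_le (q := q) (by simp)).eq_or_lt with heq | hlt
    · obtain ⟨r, h1, h2, h3⟩ := ih h.tail
      refine ⟨r, ?_, h2.trans heq.symm, Or.inr (by rcases h3 with rfl | h3 <;> simp [*])⟩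
      rw [interpolant_of_le heq.le heq.ge, heq, h1]
    · refine ⟨p, ?_, rfl, Or.inl rfl⟩
      rw [interpolant_eq_wave le_rfl hlt,
        H.wave_left (h.mem p (by simp)) (h.mem q (by simp)) hlt]

/-- No variation hides inside a cluster: either `q` is its last particle, or `p`, `q` and the last
particle are three at one position, which forces their speeds to decrease weakly. -/
theorem Admissible.val_mem_uIcc (H : GenuinelyNonlinear f I) (h : Admissible f I (p :: q :: l))
    (hpq : p.pos = q.pos) : q.val ∈ uIcc p.val (interpolant f (q :: l) q.pos) := by
  obtain ⟨r, hr, hrq, rfl | hrl⟩ := exists_interpolant_head H h.tail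
  · rw [hr]; exact right_mem_uIcc
  · rw [hr]
    have hs : [p, q, r].Sublist (p :: q :: l) :=
      ((List.singleton_sublist.2 hrl).cons_cons q).cons_cons p
    have hf : ([p, q, r].filter fun s => s.pos = p.pos) = [p, q, r] := by
      simp [hpq, hrq]
    have hs' := hs.filter fun s => decide (s.pos = p.pos)
    rw [hf] at hs'
    have hpw := ((h.clustered p.pos).resolve_left fun hlen => by
      have := hs'.length_le
      simp only [List.length_cons, List.length_nil] at this
      omega).sublist hs'
    simp only [List.pairwise_cons, List.mem_cons, List.not_mem_nil, or_false, forall_eq_or_imp,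
      forall_eq] at hpw
    refine H.mem_uIcc_of_deriv_mem (h.mem p (by simp)) (h.mem r (by simp [hrl]))
      (h.mem q (by simp)) ?_
    exact mem_uIcc.2 (Or.inr ⟨hpw.2.1, hpw.1.1⟩)

theorem tendsto_interpolant_left (H : GenuinelyNonlinear f I) (hp : p.val ∈ I) (hq : q.val ∈ I)
    (hpq : p.pos < q.pos) :
    Filter.Tendsto (interpolant f (p :: q :: l)) (nhdsWithin q.pos (Iio q.pos)) (nhds q.val) := by
  rw [← nhdsWithin_Ioo_eq_nhdsLT hpq]
  have h1 : Filter.Tendsto (wave f p q) (nhdsWithin q.pos (Ioo p.pos q.pos)) (nhds q.val) := by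
    have := (H.continuousOn_wave hp hq hpq) q.pos ⟨hpq.le, le_rfl⟩
    rw [ContinuousWithinAt, H.wave_right hp hq hpq] at this
    exact this.mono_left (nhdsWithin_mono _ Ioo_subset_Icc_self)
  refine h1.congr' ?_
  filter_upwards [self_mem_nhdsWithin] with y hy
  exact (interpolant_eq_wave hy.1.le hy.2).symm

/-- If the represented function takes values in a closed interval, so do the particles. -/
theorem Admissible.val_mem_Icc (H : GenuinelyNonlinear f I) (h : Admissible f I c) {a b : ℝ}
    (hx : ∀ x, interpolant f c x ∈ Icc a b) : ∀ r ∈ c, r.val ∈ Icc a b := by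
  induction c with
  | nil => simp
  | cons p l ih =>
    have hp : p.val ∈ Icc a b := by
      have := hx (p.pos - 1)
      rwa [interpolant_of_lt (by linarith)] at this
    rw [List.forall_mem_cons]
    refine ⟨hp, ?_⟩
    cases l with
    | nil => simp
    | cons q l =>
      have hpq : p.pos ≤ q.pos := h.pos_le (by simp)
      have hq : q.val ∈ Icc a b := by
        rcases hpq.eq_or_lt with heq | hlt
        · have h1 := h.val_mem_uIcc H heq
          have h2 := hx q.pos
          rw [interpolant_of_le hpq le_rfl] at h2
          exact ordConnected_Icc.uIcc_subset hp h2 h1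
        · exact isClosed_Icc.mem_of_tendsto
            (tendsto_interpolant_left (l := l) H (h.mem p (by simp)) (h.mem q (by simp)) hlt)
            (Filter.Eventually.of_forall hx)
      refine ih h.tail fun x => ?_
      rcases lt_or_ge x q.pos with h1 | h1
      · rwa [interpolant_of_lt h1]
      · rw [← interpolant_of_le hpq h1]; exact hx x

/-! ### Total variation -/

/-- The sum of the absolute increments of the values of the particles. -/
noncomputable def valueVariation : List Particle → ENNReal
  | [] => 0
  | [_] => 0
  | p :: q :: l => edist p.val q.val + valueVariation (q :: l)

theorem valueVariation_ne_top (c : List Particle) : valueVariation c ≠ ⊤ := by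
  induction c with
  | nil => simp [valueVariation]
  | cons p l ih =>
    cases l with
    | nil => simp [valueVariation]
    | cons q l => exact ENNReal.add_ne_top.2 ⟨edist_ne_top _ _, ih⟩

theorem eVariationOn_add_le (u v : ℝ → ℝ) (s : Set ℝ) :
    eVariationOn (fun x => u x + v x) s ≤ eVariationOn u s + eVariationOn v s := by
  refine iSup_le fun a => ?_
  calc ∑ i ∈ Finset.range a.1, edist (u (a.2.1 (i + 1)) + v (a.2.1 (i + 1)))
        (u (a.2.1 i) + v (a.2.1 i))
      ≤ ∑ i ∈ Finset.range a.1, (edist (u (a.2.1 (i + 1))) (u (a.2.1 i))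
          + edist (v (a.2.1 (i + 1))) (v (a.2.1 i))) :=
        Finset.sum_le_sum fun i _ => edist_add_add_le _ _ _ _
    _ ≤ _ := by
      rw [Finset.sum_add_distrib]
      exact add_le_add (eVariationOn.sum_le a.2.2.1 a.2.2.2) (eVariationOn.sum_le a.2.2.1 a.2.2.2)

theorem eVariationOn_le_of_monotone {u : ℝ → ℝ} {a b : ℝ} (hu : Monotone u)
    (h : ∀ x, u x ∈ Icc a b) : eVariationOn u univ ≤ ENNReal.ofReal (b - a) := by
  rw [eVariationOn.eq_biSup_inter_Icc]
  refine iSup₂_le fun s hs => ?_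
  rw [(hu.monotoneOn univ).eVariationOn_eq (mem_univ _) (mem_univ _)]
  exact ENNReal.ofReal_le_ofReal (by linarith [(h s.1).1, (h s.2).2])

theorem interpolant_pair_mem (H : GenuinelyNonlinear f I) (hp : p.val ∈ I) (hq : q.val ∈ I)
    (x : ℝ) : interpolant f [p, q] x ∈ uIcc p.val q.val :=
  H.interpolant_mem (by simp) (by simp [hp, hq]) (by simp) x

theorem interpolant_pair_mem_uIcc (H : GenuinelyNonlinear f I) (hp : p.val ∈ I) (hq : q.val ∈ I)
    (hxy : x ≤ y) :
    interpolant f [p, q] x ∈ uIcc p.val (interpolant f [p, q] y) := by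
  rcases lt_or_ge x p.pos with h1 | h1
  · rw [interpolant_of_lt h1]; exact left_mem_uIcc
  rcases lt_or_ge y q.pos with h2 | h2
  · rw [interpolant_eq_wave h1 (hxy.trans_lt h2), interpolant_eq_wave (h1.trans hxy) h2]
    exact H.wave_mem_uIcc_wave hp hq (by linarith) h1 hxy h2.le
  · have : interpolant f [p, q] y = q.val := by
      simp [interpolant, (h1.trans hxy).not_gt, h2.not_gt]
    rw [this]
    exact interpolant_pair_mem H hp hq x

theorem eVariationOn_interpolant_pair_le (H : GenuinelyNonlinear f I) (hp : p.val ∈ I)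
    (hq : q.val ∈ I) : eVariationOn (interpolant f [p, q]) univ ≤ edist p.val q.val := by
  rw [edist_dist, Real.dist_eq]
  have hm := interpolant_pair_mem H hp hq
  rcases le_total p.val q.val with h | h
  · rw [uIcc_of_le h] at hm
    rw [abs_sub_comm, abs_of_nonneg (sub_nonneg.2 h)]
    refine eVariationOn_le_of_monotone (fun x y hxy => ?_) hm
    have := interpolant_pair_mem_uIcc H hp hq hxy
    rw [uIcc_of_le (hm y).1] at this
    exact this.2
  · rw [uIcc_of_ge h] at hm
    rw [abs_of_nonneg (sub_nonneg.2 h)]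
    have hanti : Antitone (interpolant f [p, q]) := fun x y hxy => by
      have := interpolant_pair_mem_uIcc H hp hq hxy
      rw [uIcc_of_ge (hm y).2] at this
      exact this.1
    have := eVariationOn.comp_eq_of_antitoneOn (interpolant f [p, q]) (t := univ)
      (fun x => -x) (fun a _ b _ hab => neg_le_neg hab)
    rw [image_univ, (neg_surjective (G := ℝ)).range_eq] at this
    rw [← this]
    exact eVariationOn_le_of_monotone (fun x y hxy => hanti (neg_le_neg hxy)) fun x => hm _

/-- Splitting off the first wave as a summand reduces inductions over the list to subadditivity of
the variation and to continuity of sums. -/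
theorem interpolant_eq_add (hpq : p.pos ≤ q.pos) (x : ℝ) :
    interpolant f (p :: q :: l) x
      = interpolant f [p, q] x + (interpolant f (q :: l) x - q.val) := by
  rcases lt_or_ge x q.pos with h | h
  · rw [interpolant_of_lt h, sub_self, add_zero]
    simp [interpolant, h]
  · rw [interpolant_of_le hpq h, interpolant_of_le hpq h]
    simp [interpolant]

theorem eVariationOn_interpolant_le (H : GenuinelyNonlinear f I) (hI : ∀ p ∈ c, p.val ∈ I)
    (ho : Ordered c) : eVariationOn (interpolant f c) univ ≤ valueVariation c := by
  induction c with
  | nil => exact (eVariationOn.constant_on (by simp [interpolant, Set.Subsingleton])).le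
  | cons p l ih =>
    cases l with
    | nil => exact (eVariationOn.constant_on (by simp [interpolant, Set.Subsingleton])).le
    | cons q l =>
      have hpq : p.pos ≤ q.pos := (List.pairwise_cons.1 ho).1 q (by simp)
      have ih' := ih (fun r hr => hI r (List.mem_cons_of_mem _ hr)) (List.pairwise_cons.1 ho).2
      rw [funext (interpolant_eq_add (f := f) (l := l) hpq)]
      refine (eVariationOn_add_le _ _ _).trans (add_le_add
        (eVariationOn_interpolant_pair_le H (hI p (by simp)) (hI q (by simp)))
        (le_trans ?_ ih'))
      simp only [sub_eq_add_neg]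
      refine (eVariationOn_add_le _ (fun _ => -q.val) _).trans ?_
      rw [eVariationOn.constant_on (f := fun _ : ℝ => -q.val)
        (by rw [image_univ, range_const]; exact subsingleton_singleton), add_zero]

theorem eVariationOn_univ (u : ℝ → ℝ) (b : ℝ) :
    eVariationOn u univ = eVariationOn u (Iic b) + eVariationOn u (Ici b) := by
  rw [← eVariationOn.union u isGreatest_Iic isLeast_Ici, Iic_union_Ici]

theorem edist_add_edist_of_mem_uIcc {a b d : ℝ} (h : b ∈ uIcc a d) :
    edist a b + edist b d = edist a d := by
  rw [← segment_eq_uIcc] at h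
  rw [edist_dist, edist_dist, edist_dist, ← ENNReal.ofReal_add dist_nonneg dist_nonneg,
    dist_add_dist_of_mem_segment h]

/-- The upper bound holds for every ordered list with values in `I`; only this direction needs
clusters without hidden variation. -/
theorem Admissible.valueVariation_le (H : GenuinelyNonlinear f I) (h : Admissible f I c) :
    valueVariation c ≤ eVariationOn (interpolant f c) univ := by
  induction c with
  | nil => simp [valueVariation]
  | cons p l ih =>
    cases l with
    | nil => simp [valueVariation]
    | cons q l =>
      have hpq : p.pos ≤ q.pos := h.pos_le (by simp)
      have hpI := h.mem p (by simp)
      have hqI := h.mem q (by simp)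
      set u := interpolant f (p :: q :: l) with hu
      set z := interpolant f (q :: l) q.pos with hz
      have huz : u q.pos = z := interpolant_of_le hpq le_rfl
      have hzI : z ∈ I := by
        have := H.ordConnected
        exact H.interpolant_mem (by simp) h.tail.mem h.tail.mem q.pos
      -- The function of the tail continues `q.val` to the left of `q.pos`; its variation there is
      -- only the jump from `q.val` to `z`.
      have htail : valueVariation (q :: l) ≤ edist q.val z + eVariationOn u (Ici q.pos) := by
        refine (ih h.tail).trans ?_
        rw [eVariationOn_univ _ q.pos]
        refine add_le_add ?_ (eVariationOn.congr fun x hx => (interpolant_of_le hpq hx).symm).le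
        refine le_trans ?_ (eVariationOn_interpolant_pair_le (p := ⟨q.pos, q.val⟩)
          (q := ⟨q.pos, z⟩) H hqI hzI)
        refine le_trans (eVariationOn.congr fun x hx => ?_).le (eVariationOn.mono _ (subset_univ _))
        rcases (show x ≤ q.pos from hx).eq_or_lt with rfl | hlt
        · simp [interpolant, hz]
        · rw [interpolant_of_lt hlt, interpolant_of_lt (by exact hlt)]
      refine (add_le_add le_rfl htail).trans ?_
      rw [← add_assoc]
      have hleft : ∀ x, u (min x p.pos - 1) = p.val := fun x =>
        interpolant_of_lt (by linarith [min_le_right x p.pos])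
      rcases hpq.eq_or_lt with heq | hlt
      · rw [edist_add_edist_of_mem_uIcc (h.val_mem_uIcc H heq), eVariationOn_univ u q.pos]
        refine add_le_add ?_ le_rfl
        rw [← hz, ← huz, ← hleft q.pos]
        exact eVariationOn.edist_le u
          (mem_Iic.2 (by linarith [min_le_left q.pos p.pos])) self_mem_Iic
      -- If there is a jump at `q.pos`, the value `q.val` is only a left limit. The estimate is
      -- proved with sample points `x < q.pos` and passed to the limit.
      · have hlim : Filter.Tendsto
            (fun x => edist p.val (u x) + edist (u x) z + eVariationOn u (Ici q.pos))
            (nhdsWithin q.pos (Iio q.pos))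
            (nhds (edist p.val q.val + edist q.val z + eVariationOn u (Ici q.pos))) := by
          have := tendsto_interpolant_left (l := l) H hpI hqI hlt
          exact ((tendsto_const_nhds.edist this).add (this.edist tendsto_const_nhds)).add
            tendsto_const_nhds
        refine le_of_tendsto hlim ?_
        filter_upwards [self_mem_nhdsWithin] with x hx
        have hx' : x < q.pos := hx
        rw [eVariationOn_univ u q.pos]
        refine add_le_add (le_trans (add_le_add (b := eVariationOn u (Iic x))
          (d := eVariationOn u (Icc x q.pos)) ?_ ?_) ?_) le_rfl
        · rw [← hleft x]
          exact eVariationOn.edist_le u 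
            (mem_Iic.2 (by linarith [min_le_left x p.pos])) self_mem_Iic
        · rw [← huz]
          exact eVariationOn.edist_le u ⟨le_rfl, hx'.le⟩ ⟨hx'.le, le_rfl⟩
        · rw [← eVariationOn.union u isGreatest_Iic (isLeast_Icc hx'.le),
            Iic_union_Icc_eq_Iic hx'.le]

theorem Admissible.eVariationOn_interpolant (H : GenuinelyNonlinear f I) (h : Admissible f I c) :
    eVariationOn (interpolant f c) univ = valueVariation c :=
  (eVariationOn_interpolant_le H h.mem h.ordered).antisymm (h.valueVariation_le H)

end Interpolant

end ParticleMethod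

/-! ### Total entropy as a function of the particles, and its change under movement. -/

namespace ParticleMethod

section Management

variable {f η θ : ℝ → ℝ} {I : Set ℝ} {p q new : Particle} {l r c c' : List Particle}
  {x y s uL uR : ℝ}

/-! ### The integral of an entropy -/

/-- The contribution of the similarity waves to the total entropy, with the contribution of the
last particle normalized at the origin. -/
noncomputable def entropySum (f η θ : ℝ → ℝ) : List Particle → ℝ
  | [] => 0
  | [p] => -(η p.val * p.pos)
  | p :: q :: l => (q.pos - p.pos) * waveAverage f η θ p.val q.val + entropySum f η θ (q :: l)

/-- The total entropy of the represented function, up to the contributions of the constant states,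
which are normalized at the origin. -/
noncomputable def totalEntropy (f η θ : ℝ → ℝ) : List Particle → ℝ
  | [] => 0
  | p :: l => η p.val * p.pos + entropySum f η θ (p :: l)

theorem integral_interpolant_gap (H : GenuinelyNonlinear f I) (h : IsEntropyPair f η θ)
    (hp : p.val ∈ I) (hq : q.val ∈ I) (hpq : p.pos ≤ q.pos) :
    IntervalIntegrable (fun x => η (interpolant f (p :: q :: l) x)) volume p.pos q.pos ∧
    ∫ x in p.pos..q.pos, η (interpolant f (p :: q :: l) x)
      = (q.pos - p.pos) * waveAverage f η θ p.val q.val := by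
  have heq : EqOn (fun x => η (wave f p q x))
      (fun x => η (interpolant f (p :: q :: l) x)) (uIoo p.pos q.pos) := fun x hx => by
    rw [uIoo_of_le hpq] at hx
    simp only [interpolant_eq_wave (f := f) (l := l) hx.1.le hx.2]
  rw [← intervalIntegral.integral_congr_uIoo heq]
  rcases hpq.eq_or_lt with hpq' | hlt
  · rw [hpq']; simp
  · refine ⟨((h.continuous.comp_continuousOn
      (H.continuousOn_wave hp hq hlt)).intervalIntegrable_of_Icc hpq).congr_uIoo heq, ?_⟩
    rw [H.integral_wave h hp hq hlt ⟨hpq, le_rfl⟩, H.wave_right hp hq hlt]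

theorem integral_interpolant_Icc (H : GenuinelyNonlinear f I) (h : IsEntropyPair f η θ)
    (hI : ∀ r ∈ p :: l, r.val ∈ I) (ho : Ordered (p :: l)) {b : ℝ}
    (hb : ∀ r ∈ p :: l, r.pos ≤ b) :
    IntervalIntegrable (fun x => η (interpolant f (p :: l) x)) volume p.pos b ∧
    ∫ x in p.pos..b, η (interpolant f (p :: l) x)
      = η ((p :: l).getLast (List.cons_ne_nil p l)).val * b + entropySum f η θ (p :: l) := by
  induction l generalizing p with
  | nil =>
    simp only [interpolant, intervalIntegrable_const, intervalIntegral.integral_const, entropySum,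
      List.getLast_singleton, smul_eq_mul, true_and]
    ring
  | cons q l ih =>
    have hpq : p.pos ≤ q.pos := (List.pairwise_cons.1 ho).1 q (by simp)
    have hqb : q.pos ≤ b := hb q (by simp)
    obtain ⟨hint, hval⟩ := ih (fun r hr => hI r (List.mem_cons_of_mem _ hr))
      (List.pairwise_cons.1 ho).2 (fun r hr => hb r (List.mem_cons_of_mem _ hr))
    have heq2 : EqOn (fun x => η (interpolant f (q :: l) x))
        (fun x => η (interpolant f (p :: q :: l) x)) (uIoo q.pos b) := fun x hx => by
      rw [uIoo_of_le hqb] at hx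
      simp only [interpolant_of_le (f := f) (l := l) hpq hx.1.le]
    have hint2 := hint.congr_uIoo heq2
    obtain ⟨hint1, hgap⟩ := integral_interpolant_gap (l := l) H h (hI p (by simp)) (hI q (by simp))
      hpq
    refine ⟨hint1.trans hint2, ?_⟩
    rw [← intervalIntegral.integral_add_adjacent_intervals hint1 hint2,
      hgap, ← intervalIntegral.integral_congr_uIoo heq2, hval, List.getLast_cons (List.cons_ne_nil q l), entropySum]
    ring

theorem integral_interpolant (H : GenuinelyNonlinear f I) (h : IsEntropyPair f η θ)
    (hI : ∀ r ∈ c, r.val ∈ I) (ho : Ordered c) (hL : c.head?.map Particle.val = some uL)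
    (hR : c.getLast?.map Particle.val = some uR) {a b : ℝ}
    (ha : ∀ r ∈ c, a ≤ r.pos) (hb : ∀ r ∈ c, r.pos ≤ b) :
    IntervalIntegrable (fun x => η (interpolant f c x)) volume a b ∧
    ∫ x in a..b, η (interpolant f c x) = η uR * b - η uL * a + totalEntropy f η θ c := by
  cases c with
  | nil => simp at hL
  | cons p l =>
    obtain ⟨hint, hval⟩ := integral_interpolant_Icc H h hI ho hb
    simp only [List.head?_cons, Option.map_some, Option.some.injEq] at hL
    rw [List.getLast?_eq_getLast_of_ne_nil (List.cons_ne_nil p l), Option.map_some,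
      Option.some.injEq] at hR
    have hap : a ≤ p.pos := ha p (by simp)
    have heq : EqOn (fun _ => η uL) (fun x => η (interpolant f (p :: l) x)) (uIoo a p.pos) :=
      fun x hx => by
        rw [uIoo_of_le hap] at hx
        simp only [interpolant_of_lt (f := f) (l := l) hx.2, hL]
    have hint1 : IntervalIntegrable (fun x => η (interpolant f (p :: l) x)) volume a p.pos :=
      intervalIntegrable_const.congr_uIoo heq
    refine ⟨hint1.trans hint, ?_⟩
    rw [← intervalIntegral.integral_add_adjacent_intervals hint1 hint,
      ← intervalIntegral.integral_congr_uIoo heq, hval, hR, totalEntropy, hL]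
    simp only [intervalIntegral.integral_const, smul_eq_mul]
    ring

/-- An admissible list of particles with given constant states at `±∞`. -/
structure State (f : ℝ → ℝ) (I : Set ℝ) (uL uR : ℝ) (c : List Particle) : Prop
    extends Admissible f I c where
  head : c.head?.map Particle.val = some uL
  last : c.getLast?.map Particle.val = some uR

theorem State.ne_nil (h : State f I uL uR c) : c ≠ [] := by
  rintro rfl
  simpa using h.head

theorem State.interpolant_left (h : State f I uL uR c) (hx : ∀ r ∈ c, x < r.pos) :
    interpolant f c x = uL := by
  cases c with
  | nil => exact absurd rfl h.ne_nil
  | cons p l =>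
    rw [interpolant_of_lt (hx p (by simp))]
    simpa using h.head

theorem State.interpolant_right (h : State f I uL uR c) (hx : ∀ r ∈ c, r.pos ≤ x) :
    interpolant f c x = uR := by
  cases c with
  | nil => exact absurd rfl h.ne_nil
  | cons p l =>
    rw [interpolant_getLast hx]
    have := h.last
    rwa [List.getLast?_eq_getLast_of_ne_nil (List.cons_ne_nil p l), Option.map_some,
      Option.some.injEq] at this

theorem exists_pos_bound (c : List Particle) : ∃ M : ℝ, ∀ r ∈ c, |r.pos| < M := by
  induction c with
  | nil => exact ⟨0, by simp⟩
  | cons p l ih =>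
    obtain ⟨M, hM⟩ := ih
    refine ⟨max M (|p.pos| + 1), ?_⟩
    rw [List.forall_mem_cons]
    exact ⟨lt_max_of_lt_right (by linarith), fun r hr => lt_max_of_lt_left (hM r hr)⟩

/-- Outside a bounded interval both functions equal the same constants, so the boundary terms of
`integral_interpolant` cancel in the difference. -/
theorem State.integral_sub (H : GenuinelyNonlinear f I) (hE : IsEntropyPair f η θ)
    (h : State f I uL uR c) (h' : State f I uL uR c') :
    Integrable (fun x => η (interpolant f c' x) - η (interpolant f c x)) ∧
    ∫ x, (η (interpolant f c' x) - η (interpolant f c x))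
      = totalEntropy f η θ c' - totalEntropy f η θ c := by
  obtain ⟨M, hM⟩ := exists_pos_bound (c ++ c')
  have h1 : ∀ r ∈ c, -M < r.pos ∧ r.pos < M := fun r hr => abs_lt.1 (hM r (by simp [hr]))
  have h2 : ∀ r ∈ c', -M < r.pos ∧ r.pos < M := fun r hr => abs_lt.1 (hM r (by simp [hr]))
  have hsupp : Function.support (fun x => η (interpolant f c' x) - η (interpolant f c x))
      ⊆ Ioc (-M) M := by
    intro x hx
    by_contra hx'
    apply hx
    rw [mem_Ioc, not_and_or, not_lt, not_le] at hx'
    rcases hx' with hx' | hx'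
    · simp only [h.interpolant_left fun r hr => hx'.trans_lt (h1 r hr).1,
        h'.interpolant_left fun r hr => hx'.trans_lt (h2 r hr).1, sub_self]
    · simp only [h.interpolant_right fun r hr => ((h1 r hr).2.trans hx').le,
        h'.interpolant_right fun r hr => ((h2 r hr).2.trans hx').le, sub_self]
  obtain ⟨i1, e1⟩ := integral_interpolant H hE h.mem h.ordered h.head h.last
    (fun r hr => (h1 r hr).1.le) (fun r hr => (h1 r hr).2.le)
  obtain ⟨i2, e2⟩ := integral_interpolant H hE h'.mem h'.ordered h'.head h'.last
    (fun r hr => (h2 r hr).1.le) (fun r hr => (h2 r hr).2.le)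
  refine ⟨(integrableOn_iff_integrable_of_support_subset hsupp).1 (i2.sub i1).1, ?_⟩
  rw [← intervalIntegral.integral_eq_integral_of_support_subset hsupp,
    intervalIntegral.integral_sub i2 i1, e1, e2]
  ring

/-! ### Movement -/

theorem move_zero (f : ℝ → ℝ) (c : List Particle) : move f 0 c = c := by
  simp [move]

theorem move_move (f : ℝ → ℝ) (s t : ℝ) (c : List Particle) :
    move f t (move f s c) = move f (s + t) c := by
  simp only [move, List.map_map]
  congr 1
  funext p
  simp only [Function.comp_apply, Particle.mk.injEq, and_true]
  ring

theorem forall_mem_move {P : ℝ → Prop} : (∀ p ∈ move f s c, P p.val) ↔ ∀ p ∈ c, P p.val := by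
  simp [move]

theorem valueVariation_move : valueVariation (move f s c) = valueVariation c := by
  induction c with
  | nil => rfl
  | cons p l ih =>
    cases l with
    | nil => rfl
    | cons q l =>
      simp only [move, List.map_cons, valueVariation] at ih ⊢
      rw [ih]

/-- Two ordered particles that meet after a positive time can only do so if the left one is at least
as fast. For `s = 0` this fails, since initial jumps of either sign are allowed. -/
theorem Admissible.move (h : Admissible f I c) (hs : 0 ≤ s) (ho : Ordered (move f s c)) :
    Admissible f I (move f s c) := by
  refine ⟨forall_mem_move.2 h.mem, ho, ?_⟩
  rcases hs.eq_or_lt with rfl | hs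
  · rw [move_zero]; exact h.clustered
  · have hpw : (ParticleMethod.move f s c).Pairwise
        fun p q => p.pos = q.pos → deriv f q.val ≤ deriv f p.val := by
      refine List.pairwise_map.2 (h.ordered.imp fun {p q} hpq heq => ?_)
      simp only at heq ⊢
      by_contra! hlt
      nlinarith
    intro y
    refine Or.inr ((hpw.filter _).imp_of_mem fun hp hq hpq => hpq ?_)
    simp only [List.mem_filter, decide_eq_true_eq] at hp hq
    rw [hp.2, hq.2]

theorem State.move (h : State f I uL uR c) (hs : 0 ≤ s) (ho : Ordered (move f s c)) :
    State f I uL uR (move f s c) where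
  toAdmissible := h.toAdmissible.move hs ho
  head := by
    rw [← h.head]
    cases c <;> simp [ParticleMethod.move]
  last := by
    rw [← h.last]
    simp [ParticleMethod.move, List.getLast?_map, Function.comp_def]

/-- Each width changes by `s Δf'`, so each wave contributes `s ΔP` and the sum telescopes. At the
last particle the normalizing term removes `f' η` from `P` and leaves `-θ`. -/
theorem entropySum_move (H : GenuinelyNonlinear f I) (hI : ∀ r ∈ p :: l, r.val ∈ I) :
    entropySum f η θ (move f s (p :: l)) = entropySum f η θ (p :: l)
      - s * (θ ((p :: l).getLast (List.cons_ne_nil p l)).val + potential f η θ p.val) := by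
  induction l generalizing p with
  | nil =>
    simp only [move, List.map_cons, List.map_nil, entropySum, potential, List.getLast_singleton]
    ring
  | cons q l ih =>
    have ih := ih fun r hr => hI r (List.mem_cons_of_mem _ hr)
    have hA := H.waveAverage_mul η θ (hI p (by simp)) (hI q (by simp))
    simp only [move, List.map_cons, entropySum] at ih ⊢
    rw [ih, List.getLast_cons (List.cons_ne_nil q l)]
    linear_combination s * hA

theorem State.totalEntropy_move (H : GenuinelyNonlinear f I) (h : State f I uL uR c) :
    totalEntropy f η θ (ParticleMethod.move f s c) = totalEntropy f η θ c - s * (θ uR - θ uL) := by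
  have hL := h.head
  have hR := h.last
  cases c with
  | nil => exact absurd rfl h.ne_nil
  | cons p l =>
    have := entropySum_move (η := η) (θ := θ) (s := s) H h.mem
    simp only [List.head?_cons, Option.map_some, Option.some.injEq] at hL
    rw [List.getLast?_eq_getLast_of_ne_nil (List.cons_ne_nil p l), Option.map_some,
      Option.some.injEq] at hR
    simp only [ParticleMethod.move, List.map_cons, totalEntropy] at this ⊢
    rw [this, hR, potential, hL]
    ring

end Management

end ParticleMethod

/-! ### Locality of the operations; insertion and removal. -/

namespace ParticleMethod

section Operations

variable {f η θ : ℝ → ℝ} {I : Set ℝ} {p q new : Particle} {l r c c' : List Particle}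
  {x y s uL uR : ℝ}

/-! ### Appending lists -/

/-- The recursion either stops at `x` before it reaches `p` or continues with the list from `p` on.
Changes behind `p` can therefore be studied without the prefix. -/
theorem interpolant_append (a b : List Particle) (x : ℝ) :
    interpolant f (l ++ p :: a) x = interpolant f (l ++ p :: b) x ∨
    (interpolant f (l ++ p :: a) x = interpolant f (p :: a) x ∧
      interpolant f (l ++ p :: b) x = interpolant f (p :: b) x) := by
  induction l with
  | nil => exact Or.inr ⟨rfl, rfl⟩
  | cons m l ih =>
    cases l with
    | nil =>
      simp only [List.cons_append, List.nil_append, interpolant]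
      split_ifs
      · exact Or.inl rfl
      · exact Or.inl rfl
      · exact Or.inr ⟨rfl, rfl⟩
    | cons m' l =>
      simp only [List.cons_append, interpolant] at ih ⊢
      split_ifs
      · exact Or.inl rfl
      · exact Or.inl rfl
      · exact ih

theorem interpolant_append_congr {a b : List Particle}
    (h : ∀ x, interpolant f (p :: a) x = interpolant f (p :: b) x) :
    interpolant f (l ++ p :: a) = interpolant f (l ++ p :: b) := by
  funext x
  rcases interpolant_append a b x with h1 | ⟨h1, h2⟩
  · exact h1
  · rw [h1, h2, h]

theorem valueVariation_append_le {a b : List Particle}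
    (h : valueVariation (p :: a) ≤ valueVariation (p :: b)) :
    valueVariation (l ++ p :: a) ≤ valueVariation (l ++ p :: b) := by
  induction l with
  | nil => exact h
  | cons m l ih =>
    cases l with
    | nil => exact add_le_add le_rfl ih
    | cons m' l => exact add_le_add le_rfl ih

theorem entropySum_append_congr {a b : List Particle}
    (h : entropySum f η θ (p :: a) = entropySum f η θ (p :: b)) :
    entropySum f η θ (l ++ p :: a) = entropySum f η θ (l ++ p :: b) := by
  induction l with
  | nil => exact h
  | cons m l ih =>
    cases l with
    | nil => simpa [entropySum] using h
    | cons m' l => simpa [entropySum] using ih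

theorem totalEntropy_append_congr {a b : List Particle}
    (h : entropySum f η θ (p :: a) = entropySum f η θ (p :: b)) :
    totalEntropy f η θ (l ++ p :: a) = totalEntropy f η θ (l ++ p :: b) := by
  cases l with
  | nil => simpa [totalEntropy] using h
  | cons m l => simpa [totalEntropy] using entropySum_append_congr (l := m :: l) h

theorem Admissible.insert (h : Admissible f I (l ++ r)) (hnew : new.val ∈ I)
    (hl : ∀ a ∈ l, a.pos < new.pos) (hr : ∀ b ∈ r, new.pos < b.pos) :
    Admissible f I (l ++ new :: r) := by
  refine ⟨fun a ha => ?_, ?_, fun y => ?_⟩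
  · simp only [List.mem_append, List.mem_cons] at ha
    rcases ha with ha | rfl | ha
    · exact h.mem a (by simp [ha])
    · exact hnew
    · exact h.mem a (by simp [ha])
  · have ho := List.pairwise_append.1 h.ordered
    refine List.pairwise_append.2 ⟨ho.1, List.pairwise_cons.2 ⟨fun b hb => (hr b hb).le, ho.2.1⟩,
      fun a ha b hb => ?_⟩
    rcases List.mem_cons.1 hb with rfl | hb
    · exact (hl a ha).le
    · exact ho.2.2 a ha b hb
  · by_cases hy : new.pos = y
    · left
      have h1 : (l.filter fun p => p.pos = y) = [] :=
        List.filter_eq_nil_iff.2 fun a ha => by simpa [← hy] using (hl a ha).ne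
      have h2 : (r.filter fun p => p.pos = y) = [] :=
        List.filter_eq_nil_iff.2 fun a ha => by simpa [← hy] using (hr a ha).ne'
      simp [List.filter_append, h1, h2, hy]
    · have := h.clustered y
      simpa [List.filter_append, List.filter_cons, hy] using this

theorem Admissible.append_pos_le (h : Admissible f I (l ++ p :: r)) :
    (∀ a ∈ l ++ [p], a.pos ≤ p.pos) ∧ ∀ b ∈ p :: r, p.pos ≤ b.pos := by
  have ho := List.pairwise_append.1 h.ordered
  refine ⟨fun a ha => ?_, fun b hb => ?_⟩
  · rcases List.mem_append.1 ha with ha | ha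
    · exact ho.2.2 a ha p (by simp)
    · rw [List.mem_singleton.1 ha]
  · rcases List.mem_cons.1 hb with rfl | hb
    · rfl
    · exact (List.pairwise_cons.1 ho.2.1).1 b hb

/-! ### Insertion -/

/-- By affinity of `f'(u)`, the weights in `nonlinAverage_add` are proportional to the lengths of
the two parts. -/
theorem GenuinelyNonlinear.nonlinAverage_wave (H : GenuinelyNonlinear f I) (hp : p.val ∈ I)
    (hq : q.val ∈ I) (hpq : p.pos < q.pos) (hx : x ∈ Icc p.pos q.pos) :
    (x - p.pos) * nonlinAverage f p.val (wave f p q x)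
      + (q.pos - x) * nonlinAverage f (wave f p q x) q.val
      = (q.pos - p.pos) * nonlinAverage f p.val q.val := by
  obtain ⟨hw, he⟩ := H.wave_spec hp hq hpq hx
  rcases eq_or_ne p.val q.val with heq | hne
  · have hw' : wave f p q x = q.val := by simpa [heq] using hw
    rw [hw', heq]; ring
  · have hg : deriv f q.val - deriv f p.val ≠ 0 := fun h =>
      hne (H.injOn hp hq (sub_eq_zero.1 h).symm)
    have hA := H.nonlinAverage_add hp (H.wave_mem hp hq hpq hx) hq
    refine mul_right_cancel₀ hg ?_
    linear_combination (nonlinAverage f p.val (wave f p q x)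
      - nonlinAverage f (wave f p q x) q.val) * he - (q.pos - p.pos) * hA

/-- Both averages on the left increase strictly with the new value, so the equation has at most one
solution, and the value of the wave is one. -/
theorem GenuinelyNonlinear.eq_wave_of_area (H : GenuinelyNonlinear f I) (hp : p.val ∈ I)
    (hq : q.val ∈ I) (hpn : p.pos < new.pos) (hnq : new.pos < q.pos) (hnew : new.val ∈ I)
    (area : (new.pos - p.pos) * nonlinAverage f p.val new.val
        + (q.pos - new.pos) * nonlinAverage f new.val q.val
      = (q.pos - p.pos) * nonlinAverage f p.val q.val) : new.val = wave f p q new.pos := by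
  have hpq := hpn.trans hnq
  have hx : new.pos ∈ Icc p.pos q.pos := ⟨hpn.le, hnq.le⟩
  have hw := H.wave_mem hp hq hpq hx
  rw [← H.nonlinAverage_wave hp hq hpq hx] at area
  have h1 := sub_pos.2 hpn
  have h2 := sub_pos.2 hnq
  rw [nonlinAverage_comm f _ q.val, nonlinAverage_comm f _ q.val] at area
  rcases lt_trichotomy new.val (wave f p q new.pos) with h | h | h
  · nlinarith [H.nonlinAverage_lt hp hnew hw h, H.nonlinAverage_lt hq hnew hw h]
  · exact h
  · nlinarith [H.nonlinAverage_lt hp hw hnew h, H.nonlinAverage_lt hq hw hnew h]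

/-- A part of a similarity wave is a similarity wave, because `f'(u)` stays affine on it. -/
theorem interpolant_insert (H : GenuinelyNonlinear f I) (hp : p.val ∈ I)
    (hq : q.val ∈ I) (hpn : p.pos < new.pos) (hnq : new.pos < q.pos)
    (hval : new.val = wave f p q new.pos) (x : ℝ) :
    interpolant f (p :: new :: q :: r) x = interpolant f (p :: q :: r) x := by
  have hpq := hpn.trans hnq
  have hn : new.pos ∈ Icc p.pos q.pos := ⟨hpn.le, hnq.le⟩
  have hnI : new.val ∈ I := hval ▸ H.wave_mem hp hq hpq hn
  have hgn : deriv f new.val = _ := hval ▸ H.deriv_wave hp hq hpq hn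
  have h0 : q.pos - p.pos ≠ 0 := (sub_pos.2 hpq).ne'
  rcases lt_or_ge x p.pos with h1 | h1
  · rw [interpolant_of_lt h1, interpolant_of_lt h1]
  rcases lt_or_ge x q.pos with h2 | h2
  · have hx : x ∈ Icc p.pos q.pos := ⟨h1, h2.le⟩
    have hgx := H.deriv_wave hp hq hpq hx
    rw [interpolant_eq_wave h1 h2]
    rcases lt_or_ge x new.pos with h3 | h3
    · rw [interpolant_eq_wave h1 h3]
      refine H.wave_eq hp hnI hpn ?_ ?_
      · rw [hval]; exact H.wave_mem_uIcc_wave hp hq hpq h1 h3.le hnq.le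
      · rw [hgx, hgn]; ring
    · rw [interpolant_of_le hpn.le h3, interpolant_eq_wave h3 h2]
      refine H.wave_eq hnI hq hnq ?_ ?_
      · refine H.mem_uIcc_of_deriv_mem hnI hq (H.wave_mem hp hq hpq hx) ?_
        have hgq := H.deriv_wave hp hq hpq ⟨hpq.le, le_rfl⟩
        rw [H.wave_right hp hq hpq] at hgq
        rw [hgx, hgn, mem_uIcc]
        generalize (deriv f q.val - deriv f p.val) / (q.pos - p.pos) = κ at hgq
        rcases le_total 0 κ with h | h
        · left; constructor <;> nlinarith
        · right; constructor <;> nlinarith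
      · rw [hgx, hgn]; field_simp; ring
  · rw [interpolant_of_le hpn.le (hnq.le.trans h2), interpolant_of_le hnq.le h2,
      interpolant_of_le hpq.le h2]

/-! ### Removal -/

theorem interpolant_cluster {m : List Particle} (hm : ∀ a ∈ m, a.pos = p.pos)
    (hq : q.pos = p.pos) (x : ℝ) :
    interpolant f (p :: (m ++ q :: r)) x = interpolant f (p :: q :: r) x := by
  rcases lt_or_ge x p.pos with hx | hx
  · rw [interpolant_of_lt hx, interpolant_of_lt hx]
  · rw [interpolant_of_le hq.ge (hq.trans_le hx)]
    induction m generalizing p with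
    | nil => rw [List.nil_append, interpolant_of_le hq.ge (hq.trans_le hx)]
    | cons a m ih =>
      have ha := hm a (by simp)
      rw [List.cons_append, interpolant_of_le ha.ge (ha.trans_le hx)]
      exact ih (fun b hb => (hm b (by simp [hb])).trans ha.symm) (hq.trans ha.symm)
        (ha.trans_le hx)

/-- With more than two particles, admissibility makes the speeds monotone along the cluster. The
extreme values then sit at its ends, and particles at one position with equal speed are equal. -/
theorem exists_cluster_decomposition (H : GenuinelyNonlinear f I) {cl : List Particle}
    (h : Admissible f I cl) (hcard : 2 < cl.length) (hpos : ∀ a ∈ cl, a.pos = p.pos)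
    (hsub : List.Sublist [p, q] cl) (hval : ∀ a ∈ cl, a.val ∈ uIcc p.val q.val) :
    ∃ m, cl = p :: (m ++ [q]) := by
  have hpcl : p ∈ cl := hsub.subset (by simp)
  have hqcl : q ∈ cl := hsub.subset (by simp)
  have hf : (cl.filter fun a => a.pos = p.pos) = cl :=
    List.filter_eq_self.2 fun a ha => by simpa using hpos a ha
  have hpw := (h.clustered p.pos).resolve_left (by rw [hf]; omega)
  rw [hf] at hpw
  have hqp : deriv f q.val ≤ deriv f p.val := by simpa using hpw.sublist hsub
  have hg : ∀ a ∈ cl, deriv f q.val ≤ deriv f a.val ∧ deriv f a.val ≤ deriv f p.val := by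
    intro a ha
    have := H.deriv_mem_uIcc (h.mem p hpcl) (h.mem q hqcl) (hval a ha)
    rwa [uIcc_of_ge hqp] at this
  have hext : ∀ a ∈ cl, ∀ b ∈ cl, deriv f a.val = deriv f b.val → a = b := fun a ha b hb hab =>
    Particle.ext ((hpos a ha).trans (hpos b hb).symm) (H.injOn (h.mem a ha) (h.mem b hb) hab)
  obtain ⟨a, t, rfl⟩ : ∃ a t, cl = a :: t := List.exists_cons_of_length_pos (by omega)
  have htne : t ≠ [] := by rintro rfl; simp at hcard
  obtain ⟨m, b, rfl⟩ : ∃ m b, t = m ++ [b] :=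
    ⟨t.dropLast, t.getLast htne, (List.dropLast_append_getLast htne).symm⟩
  have hap : a = p := by
    refine hext a (by simp) p hpcl (le_antisymm (hg a (by simp)).2 ?_)
    rcases List.mem_cons.1 hpcl with h1 | h1
    · rw [h1]
    · exact (List.pairwise_cons.1 hpw).1 p h1
  have hbq : b = q := by
    refine hext b (by simp) q hqcl (le_antisymm ?_ (hg b (by simp)).1)
    rw [← List.cons_append] at hpw hqcl
    rcases List.mem_append.1 hqcl with h1 | h1
    · exact (List.pairwise_append.1 hpw).2.2 q h1 b (by simp)
    · rw [List.mem_singleton.1 h1]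
  exact ⟨m, by rw [hap, hbq]⟩

end Operations

end ParticleMethod

/-! ### Merging, and the composition of steps into a run. -/

namespace ParticleMethod

section Merging

variable {f η θ : ℝ → ℝ} {I : Set ℝ} {p q new p₁ p₂ p₃ p₄ : Particle} {l r c c' : List Particle}
  {x y s uL uR : ℝ}

/-- If `v` were beyond both `u₂` and `u₃` on one side, both averages would be strictly off in the
same direction. -/
theorem GenuinelyNonlinear.mem_uIcc_of_area (H : GenuinelyNonlinear f I) {X Y u₁ u₂ u₃ u₄ v : ℝ}
    (hX : 0 < X) (hY : 0 < Y) (h₁ : u₁ ∈ I) (h₂ : u₂ ∈ I) (h₃ : u₃ ∈ I) (h₄ : u₄ ∈ I)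
    (hv : v ∈ I) (area : X * nonlinAverage f u₁ v + Y * nonlinAverage f v u₄
      = X * nonlinAverage f u₁ u₂ + Y * nonlinAverage f u₃ u₄) : v ∈ uIcc u₂ u₃ := by
  rw [nonlinAverage_comm f _ u₄, nonlinAverage_comm f _ u₄] at area
  by_contra hmem
  rw [uIcc, mem_Icc, not_and_or, not_le, not_le, lt_inf_iff, sup_lt_iff] at hmem
  rcases hmem with ⟨h2, h3⟩ | ⟨h2, h3⟩
  · nlinarith [H.nonlinAverage_lt h₁ hv h₂ h2, H.nonlinAverage_lt h₄ hv h₃ h3]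
  · nlinarith [H.nonlinAverage_lt h₁ h₂ hv h2, H.nonlinAverage_lt h₄ h₃ hv h3]

/-- Compare the affine profiles of `f'(u)`. On the left they start at the same speed, and the old
one ends at a speed at least `f'(u₂₃)`; since `f'(u₁) ≥ f'(u₂₃)` by the entropy fix, the new profile
stays between `f'(u₂₃)` and the old one. On the right the inequalities are reversed. -/
theorem interpolant_merge (H : GenuinelyNonlinear f I) (h₁ : p₁.val ∈ I) (h₂ : p₂.val ∈ I)
    (h₃ : p₃.val ∈ I) (h₄ : p₄.val ∈ I) (hnew : new.val ∈ I)
    (h₁₂ : p₁.pos < p₂.pos) (h₂₃ : p₂.pos = p₃.pos) (h₃₄ : p₃.pos < p₄.pos)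
    (hpos : new.pos = p₂.pos) (hg₂ : deriv f new.val ≤ deriv f p₂.val)
    (hg₃ : deriv f p₃.val ≤ deriv f new.val)
    (accept₁ : deriv f new.val ≤ deriv f p₁.val) (accept₄ : deriv f p₄.val ≤ deriv f new.val)
    (x : ℝ) : interpolant f (p₁ :: new :: p₄ :: r) x
      ∈ uIcc new.val (interpolant f (p₁ :: p₂ :: p₃ :: p₄ :: r) x) := by
  have hn₁ : p₁.pos < new.pos := hpos ▸ h₁₂
  have hn₄ : new.pos < p₄.pos := by rw [hpos, h₂₃]; exact h₃₄
  rcases lt_or_ge x p₁.pos with hx | hx1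
  · rw [interpolant_of_lt hx, interpolant_of_lt hx]; exact right_mem_uIcc
  rcases lt_or_ge x p₂.pos with hx | hx2
  · have hxn : x < new.pos := by rwa [hpos]
    rw [interpolant_eq_wave hx1 hxn, interpolant_eq_wave hx1 hx]
    have hxm : x ∈ Icc p₁.pos p₂.pos := ⟨hx1, hx.le⟩
    have hxm' : x ∈ Icc p₁.pos new.pos := ⟨hx1, hxn.le⟩
    refine H.mem_uIcc_of_deriv_mem hnew (H.wave_mem h₁ h₂ h₁₂ hxm) (H.wave_mem h₁ hnew hn₁ hxm')
      (mem_uIcc.2 (Or.inl ?_))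
    have e1 := (H.wave_spec h₁ h₂ h₁₂ hxm).2
    have e2 := (H.wave_spec h₁ hnew hn₁ hxm').2
    rw [hpos] at e2
    have d0 : 0 < p₂.pos - p₁.pos := sub_pos.2 h₁₂
    constructor
    · refine le_of_mul_le_mul_right ?_ d0
      nlinarith
    · refine le_of_mul_le_mul_right ?_ d0
      nlinarith
  have hxn : new.pos ≤ x := by rwa [hpos]
  have hx3 : p₃.pos ≤ x := by rwa [← h₂₃]
  rw [interpolant_of_le hn₁.le hxn, interpolant_of_le h₁₂.le hx2, interpolant_of_le h₂₃.le hx3]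
  rcases lt_or_ge x p₄.pos with hx | hx4
  · rw [interpolant_eq_wave hxn hx, interpolant_eq_wave hx3 hx]
    have hxm : x ∈ Icc p₃.pos p₄.pos := ⟨hx3, hx.le⟩
    have hxm' : x ∈ Icc new.pos p₄.pos := ⟨hxn, hx.le⟩
    refine H.mem_uIcc_of_deriv_mem hnew (H.wave_mem h₃ h₄ h₃₄ hxm) (H.wave_mem hnew h₄ hn₄ hxm')
      (mem_uIcc.2 (Or.inr ?_))
    have e1 := (H.wave_spec h₃ h₄ h₃₄ hxm).2
    have e2 := (H.wave_spec hnew h₄ hn₄ hxm').2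
    rw [hpos, h₂₃] at e2
    have d0 : 0 < p₄.pos - p₃.pos := sub_pos.2 h₃₄
    constructor
    · refine le_of_mul_le_mul_right ?_ d0
      nlinarith
    · refine le_of_mul_le_mul_right ?_ d0
      nlinarith
  · rw [interpolant_of_le hn₄.le hx4, interpolant_of_le h₃₄.le hx4]; exact right_mem_uIcc

/-- The effect of an area-conserving transition in which the represented function moves towards a
single value `v`. -/
structure Contraction (f : ℝ → ℝ) (c c' : List Particle) (v : ℝ) : Prop where
  mem_uIcc : ∀ x, interpolant f c' x ∈ uIcc v (interpolant f c x)
  area : totalEntropy f id f c' = totalEntropy f id f c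
  variation : valueVariation c' ≤ valueVariation c
  mem_Icc : ∀ a b, (∀ r ∈ c, r.val ∈ Icc a b) → v ∈ Icc a b

/-- Only a merge alters the function. Its variation estimate holds because `u₁, u₂₃, u₄` is a
monotone path, hence no longer than the detour over `u₂` and `u₃`. -/
theorem Manage.admissible_and (H : GenuinelyNonlinear f I) (h : Manage f I c c')
    (hc : Admissible f I c) : Admissible f I c' ∧
      (interpolant f c' = interpolant f c ∨ ∃ v, Contraction f c c' v) := by
  cases h with
  | insert l r p q new hp hq hval area =>
    have hpI := hc.mem p (by simp)
    have hqI := hc.mem q (by simp)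
    have hle := hc.append_pos_le
    have hc2 : Admissible f I ((l ++ [p]) ++ q :: r) := by simpa using hc
    have hle2 := hc2.append_pos_le
    refine ⟨?_, Or.inl (interpolant_append_congr fun x =>
      interpolant_insert H hpI hqI hp hq (H.eq_wave_of_area hpI hqI hp hq hval area) x)⟩
    simpa using hc2.insert hval (fun a ha => (hle.1 a ha).trans_lt hp)
      fun b hb => hq.trans_le (hle2.2 b hb)
  | insertLeft r q new hq hval =>
    have hqI := hc.mem q (by simp)
    refine ⟨Admissible.insert (l := []) hc (hval ▸ hqI) (by simp) fun b hb =>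
      hq.trans_le ((Admissible.append_pos_le (l := []) hc).2 b hb), Or.inl (funext fun x => ?_)⟩
    rw [interpolant_eq_add hq.le]
    have : interpolant f [new, q] x = q.val := by
      have := interpolant_pair_mem (p := new) H (hval ▸ hqI) hqI x
      rwa [hval, uIcc_self, mem_singleton_iff] at this
    rw [this]; ring
  | insertRight l p new hp hval =>
    have hpI := hc.mem p (by simp)
    constructor
    · have hc2 : Admissible f I ((l ++ [p]) ++ []) := by simpa using hc
      simpa using hc2.insert (hval ▸ hpI)
        (fun a ha => (hc.append_pos_le.1 a ha).trans_lt hp) (by simp)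
    · refine Or.inl (interpolant_append_congr fun x => ?_)
      have := interpolant_pair_mem (q := new) H hpI (hval ▸ hpI) x
      rwa [hval, uIcc_self, mem_singleton_iff] at this
  | discard l r cl p q hcard hpos hsub hval =>
    have hcl : Admissible f I cl := hc.sublist
      ((List.sublist_append_right l cl).trans (List.sublist_append_left _ r))
    refine ⟨hc.sublist (((List.Sublist.refl l).append hsub).append (List.Sublist.refl r)),
      Or.inl ?_⟩
    have hqpos : q.pos = p.pos := hpos q (hsub.subset (by simp))
    obtain ⟨m, rfl⟩ := exists_cluster_decomposition H hcl hcard hpos hsub hval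
    have := interpolant_append_congr (l := l) fun x =>
      (interpolant_cluster (f := f) (r := r) (m := m)
        (fun a ha => hpos a (by simp [ha])) hqpos x).symm
    simpa using this
  | merge l r p₁ p₂ p₃ p₄ new h₁₂ h₂₃ h₃₄ collide hpos hval area accept₁ accept₄ =>
    have h₁ := hc.mem p₁ (by simp)
    have h₂ := hc.mem p₂ (by simp)
    have h₃ := hc.mem p₃ (by simp)
    have h₄ := hc.mem p₄ (by simp)
    -- All three positions coincide, so the middle term of the area equation has zero width.
    have hpos' : new.pos = p₂.pos := by rw [hpos, ← h₂₃]; ring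
    have hpos3 : new.pos = p₃.pos := hpos'.trans h₂₃
    have hv := H.mem_uIcc_of_area (X := p₂.pos - p₁.pos) (Y := p₄.pos - p₃.pos)
      (sub_pos.2 h₁₂) (sub_pos.2 h₃₄) h₁ h₂ h₃ h₄ hval (by
        rw [hpos'] at area
        rw [h₂₃, sub_self, zero_mul, add_zero] at area
        rw [h₂₃]; exact area)
    have hg := H.deriv_mem_uIcc h₂ h₃ hv
    rw [uIcc_of_ge collide.le] at hg
    have hv14 : new.val ∈ uIcc p₁.val p₄.val :=
      H.mem_uIcc_of_deriv_mem h₁ h₄ hval (mem_uIcc.2 (Or.inr ⟨accept₄, accept₁⟩))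
    constructor
    · have hle := hc.append_pos_le
      have hc2 : Admissible f I ((l ++ [p₁, p₂, p₃]) ++ p₄ :: r) := by simpa using hc
      have hc3 : Admissible f I ((l ++ [p₁]) ++ p₄ :: r) := hc2.sublist
        (((List.Sublist.refl l).append (by simp)).append (List.Sublist.refl _))
      simpa using hc3.insert hval (fun a ha => (hle.1 a ha).trans_lt (by rwa [hpos']))
        fun b hb => (show new.pos < p₄.pos by rwa [hpos3]).trans_le (hc2.append_pos_le.2 b hb)
    · refine Or.inr ⟨new.val, ⟨fun x => ?_, ?_, ?_, fun a b hab => ?_⟩⟩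
      · rcases interpolant_append (f := f) (l := l) (p := p₁) (new :: p₄ :: r)
          (p₂ :: p₃ :: p₄ :: r) x with h | ⟨h, h'⟩
        · rw [h]; exact right_mem_uIcc
        · rw [h, h']
          exact interpolant_merge H h₁ h₂ h₃ h₄ hval h₁₂ h₂₃ h₃₄ hpos' hg.2 hg.1 accept₁ accept₄ x
      · refine totalEntropy_append_congr ?_
        simp only [entropySum, ← nonlinAverage_eq_waveAverage]
        linear_combination area
      · refine valueVariation_append_le ?_
        simp only [valueVariation]
        rw [← add_assoc, edist_add_edist_of_mem_uIcc hv14, ← add_assoc, ← add_assoc]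
        exact add_le_add ((edist_triangle _ p₃.val _).trans
          (add_le_add (edist_triangle _ _ _) le_rfl)) le_rfl
      · exact ordConnected_Icc.uIcc_subset (hab p₁ (by simp)) (hab p₄ (by simp)) hv14

theorem State.manage (H : GenuinelyNonlinear f I) (h : Manage f I c c')
    (hc : State f I uL uR c) : State f I uL uR c' := by
  refine ⟨(h.admissible_and H hc.toAdmissible).1, ?_, ?_⟩
  · rw [← hc.head]
    cases h with
    | insert l => cases l <;> simp
    | insertLeft r q new hq hval => simp [hval]
    | insertRight l => cases l <;> simp
    | discard l r cl p q hcard hpos hsub hval =>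
      obtain ⟨m, rfl⟩ := exists_cluster_decomposition H (hc.toAdmissible.sublist
        ((List.sublist_append_right l cl).trans (List.sublist_append_left _ r)))
        hcard hpos hsub hval
      cases l <;> simp
    | merge l => cases l <;> simp
  · rw [← hc.last]
    cases h with
    | insert l r => simp [List.getLast?_append, List.getLast?_cons]
    | insertLeft r q new hq hval => simp [List.getLast?_cons]
    | insertRight l p new hp hval => simp [List.getLast?_append, hval]
    | discard l r cl p q hcard hpos hsub hval =>
      obtain ⟨m, rfl⟩ := exists_cluster_decomposition H (hc.toAdmissible.sublist
        ((List.sublist_append_right l cl).trans (List.sublist_append_left _ r)))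
        hcard hpos hsub hval
      simp [List.getLast?_append, List.getLast?_cons]
    | merge l r => simp [List.getLast?_append, List.getLast?_cons]

theorem exists_subgradient (hη : ConvexOn ℝ univ η) (v : ℝ) :
    ∃ σ, ∀ w, η v + σ * (w - v) ≤ η w := by
  have hint : v ∈ interior (univ : Set ℝ) := by simp
  refine ⟨derivWithin η (Ioi v) v, fun w => ?_⟩
  rcases lt_trichotomy w v with h | rfl | h
  · have h1 := (hη.slope_le_leftDeriv_of_mem_interior (mem_univ w) hint h).trans
      (hη.leftDeriv_le_rightDeriv_of_mem_interior hint)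
    rw [slope_def_field, div_le_iff₀ (sub_pos.2 h)] at h1
    linarith
  · simp
  · have h1 := hη.rightDeriv_le_slope_of_mem_interior hint (mem_univ w) h
    rw [slope_def_field, le_div_iff₀ (sub_pos.2 h)] at h1
    linarith

/-- Write `b = s v + t a`. Convexity gives `η b - η a ≤ s (η v - η a)`, and the subgradient at `v`
bounds this by `σ s (v - a) = σ (b - a)`. -/
theorem subgradient_contraction (hη : ConvexOn ℝ univ η) {v σ : ℝ}
    (hσ : ∀ w, η v + σ * (w - v) ≤ η w) {a b : ℝ} (hb : b ∈ uIcc v a) :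
    η b - η a ≤ σ * (b - a) := by
  rw [← segment_eq_uIcc] at hb
  obtain ⟨s, t, hs, ht, hst, rfl⟩ := hb
  have h1 := hη.2 (mem_univ v) (mem_univ a) hs ht hst
  have h2 := hσ a
  simp only [smul_eq_mul] at h1 ⊢
  have ht' : t = 1 - s := by linarith
  subst ht'
  nlinarith [mul_le_mul_of_nonneg_left h2 hs]

theorem State.totalEntropy_manage_le (H : GenuinelyNonlinear f I) (hE : IsEntropyPair f η θ)
    (h : Manage f I c c') (hc : State f I uL uR c) :
    totalEntropy f η θ c' ≤ totalEntropy f η θ c := by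
  have hc' := hc.manage H h
  obtain ⟨hint, hval⟩ := hc.integral_sub H hE hc'
  rw [← sub_nonpos, ← hval]
  rcases (h.admissible_and H hc.toAdmissible).2 with heq | ⟨v, hv⟩
  · simp [heq]
  · obtain ⟨σ, hσ⟩ := exists_subgradient hE.1 v
    obtain ⟨hint1, hval1⟩ := hc.integral_sub H H.isEntropyPair_id hc'
    -- All values move towards the same `v`, so one `σ` serves every `x` and the bound is a multiple
    -- of the change of area, which is zero.
    refine (integral_mono hint (hint1.const_mul σ) fun x =>
      subgradient_contraction hE.1 hσ (hv.mem_uIcc x)).trans ?_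
    rw [integral_const_mul, hval1, hv.area, sub_self, mul_zero]

/-! ### Transitions -/

/-- One step of the method on pairs of a time and a list of particles: characteristic movement or
an operation of the particle management. -/
def Step (f : ℝ → ℝ) (I : Set ℝ) (a b : ℝ × List Particle) : Prop :=
  (∃ s, 0 ≤ s ∧ b = (a.1 + s, move f s a.2) ∧ Ordered (move f s a.2)) ∨
    (a.1 = b.1 ∧ Manage f I a.2 b.2)

/-- What is preserved or decreased between two times. -/
structure Diminishing (f : ℝ → ℝ) (I : Set ℝ) (uL uR : ℝ) (a b : ℝ × List Particle) : Prop where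
  state : State f I uL uR b.2
  variation : eVariationOn (interpolant f b.2) univ ≤ eVariationOn (interpolant f a.2) univ
  entropy : ∀ η θ, IsEntropyPair f η θ → totalEntropy f η θ b.2 + b.1 * (θ uR - θ uL)
    ≤ totalEntropy f η θ a.2 + a.1 * (θ uR - θ uL)
  range : ∀ α β, (∀ x, interpolant f a.2 x ∈ Icc α β) → ∀ x, interpolant f b.2 x ∈ Icc α β

theorem Step.diminishing (H : GenuinelyNonlinear f I) {a b : ℝ × List Particle}
    (h : Step f I a b) (ha : State f I uL uR a.2) : Diminishing f I uL uR a b := by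
  obtain ⟨t, c⟩ := a
  obtain ⟨t', c'⟩ := b
  rcases h with ⟨s, hs, heq, ho⟩ | ⟨heq, hM⟩
  · obtain ⟨rfl, rfl⟩ := Prod.mk.inj heq
    have hb := ha.move hs ho
    refine ⟨hb, ?_, fun η θ hE => ?_, fun α β hx => ?_⟩
    · simp only
      rw [ha.toAdmissible.eVariationOn_interpolant H, hb.toAdmissible.eVariationOn_interpolant H,
        valueVariation_move]
    · simp only
      rw [ha.totalEntropy_move H]
      exact le_of_eq (by ring)
    -- A bound on the represented function also bounds the particles that are only visible as
    -- one-sided limits; their values persist while they move.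
    · exact H.interpolant_mem hb.ne_nil hb.mem
        (forall_mem_move.2 (ha.toAdmissible.val_mem_Icc H hx))
  · simp only at heq hM ha
    subst heq
    have hb := ha.manage H hM
    have hstep := (hM.admissible_and H ha.toAdmissible).2
    refine ⟨hb, ?_, fun η θ hE => ?_, fun α β hx x => ?_⟩
    · rcases hstep with heq | ⟨v, hv⟩
      · simp only [heq, le_refl]
      · simp only
        rw [ha.toAdmissible.eVariationOn_interpolant H, hb.toAdmissible.eVariationOn_interpolant H]
        exact hv.variation
    · exact add_le_add (ha.totalEntropy_manage_le H hE hM) le_rfl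
    · rcases hstep with heq | ⟨v, hv⟩
      · simp only [heq]; exact hx x
      · exact ordConnected_Icc.uIcc_subset
          (hv.mem_Icc α β (ha.toAdmissible.val_mem_Icc H hx)) (hx x) (hv.mem_uIcc x)

theorem diminishing_of_reflTransGen (H : GenuinelyNonlinear f I) {a b : ℝ × List Particle}
    (h : Relation.ReflTransGen (Step f I) a b) (ha : State f I uL uR a.2) :
    Diminishing f I uL uR a b := by
  induction h with
  | refl => exact ⟨ha, le_rfl, fun _ _ _ => le_rfl, fun _ _ hx => hx⟩
  | tail _ hstep ih =>
    have hd := hstep.diminishing H ih.state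
    exact ⟨hd.state, hd.variation.trans ih.variation,
      fun η θ hE => (hd.entropy η θ hE).trans (ih.entropy η θ hE),
      fun α β hx => hd.range α β (ih.range α β hx)⟩

namespace Run

/-- The particles at time `t` of phase `n`. -/
noncomputable def particles (R : Run f I) (n : ℕ) (t : ℝ) : List Particle :=
  move f (t - R.time n) (R.config n)

theorem reach_move (R : Run f I) {n : ℕ} {s t : ℝ}
    (ht : t ∈ Icc (R.time n) (R.time (n + 1))) (hst : s ≤ t) :
    Relation.ReflTransGen (Step f I) (s, R.particles n s) (t, R.particles n t) := by
  refine Relation.ReflTransGen.single (Or.inl ⟨t - s, sub_nonneg.2 hst, ?_, ?_⟩)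
  · simp only [particles, move_move]
    congr 1
    · ring
    · congr 1; ring
  · simp only [particles, move_move]
    convert R.no_overtaking n t ht using 2
    ring

theorem reach_manage (R : Run f I) (n : ℕ) :
    Relation.ReflTransGen (Step f I) (R.time (n + 1), R.particles n (R.time (n + 1)))
      (R.time (n + 1), R.particles (n + 1) (R.time (n + 1))) := by
  have h : R.particles (n + 1) (R.time (n + 1)) = R.config (n + 1) := by
    simp [particles, move_zero]
  rw [h]
  exact Relation.ReflTransGen.lift (p := Step f I) (fun c => (R.time (n + 1), c))
    (fun _ _ hab => Or.inr ⟨rfl, hab⟩) _ _ (R.management n)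

theorem reach (R : Run f I) {n m : ℕ} {s t : ℝ} (h : R.Before n s m t) :
    Relation.ReflTransGen (Step f I) (s, R.particles n s) (t, R.particles m t) := by
  obtain ⟨hs, ht, hnm, hst⟩ := h
  induction m, hnm using Nat.le_induction generalizing t with
  | base => exact R.reach_move ht hst
  | succ m hnm ih =>
    have h1 : R.time (m + 1) ∈ Icc (R.time m) (R.time (m + 1)) :=
      ⟨R.time_mono (Nat.le_succ m), le_rfl⟩
    exact ((ih h1 (hs.2.trans (R.time_mono (by omega)))).trans (R.reach_manage m)).trans
      (R.reach_move ht ht.1)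

theorem state_zero (R : Run f I) : State f I R.leftState R.rightState (R.config 0) where
  mem := R.init_val
  ordered := R.init_ordered
  clustered := fun y => by
    left
    have := R.init_jumps y
    rw [List.count_eq_countP, List.countP_map, List.countP_eq_length_filter] at this
    convert this using 3
    funext p
    simp [beq_eq_decide]
  head := by simp [leftState, List.head?_eq_some_head R.init_ne_nil]
  last := by simp [rightState, List.getLast?_eq_getLast_of_ne_nil R.init_ne_nil]

theorem state (H : GenuinelyNonlinear f I) (R : Run f I) {n : ℕ} {t : ℝ}
    (ht : t ∈ Icc (R.time n) (R.time (n + 1))) :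
    State f I R.leftState R.rightState (R.particles n t) := by
  have h0 : State f I R.leftState R.rightState (R.particles 0 (R.time 0)) := by
    simpa [particles, move_zero] using R.state_zero
  exact (diminishing_of_reflTransGen H (R.reach (n := 0) (s := R.time 0) (m := n) (t := t)
    ⟨⟨le_rfl, R.time_mono (Nat.le_succ 0)⟩, ht, Nat.zero_le n,
      (R.time_mono (Nat.zero_le n)).trans ht.1⟩) h0).state

theorem diminishing (H : GenuinelyNonlinear f I) (R : Run f I) {n m : ℕ} {s t : ℝ}
    (h : R.Before n s m t) :
    Diminishing f I R.leftState R.rightState (s, R.particles n s) (t, R.particles m t) :=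
  diminishing_of_reflTransGen H (R.reach h) (R.state H h.1)

end Run

/-- The path `uL, u x, u y, uR` would be longer than `uR - uL` if `u x > u y`. -/
theorem monotone_of_eVariationOn_le {u : ℝ → ℝ} {M : ℝ} (hL : ∀ x ≤ -M, u x = uL)
    (hR : ∀ x ≥ M, u x = uR) (hLR : uL ≤ uR)
    (h : eVariationOn u univ ≤ ENNReal.ofReal (uR - uL)) : Monotone u := by
  intro x y hxy
  have h1 : eVariationOn u (Iic x) + eVariationOn u (Icc x y) + eVariationOn u (Ici y)
      ≤ eVariationOn u univ := by
    rw [← eVariationOn.union u isGreatest_Iic (isLeast_Icc hxy), Iic_union_Icc_eq_Iic hxy,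
      ← eVariationOn.union u isGreatest_Iic isLeast_Ici, Iic_union_Ici]
  have h2 := eVariationOn.edist_le u (s := Iic x) (x := min x (-M)) (y := x)
    (mem_Iic.2 (min_le_left _ _)) self_mem_Iic
  have h3 := eVariationOn.edist_le u (s := Icc x y) ⟨le_rfl, hxy⟩ ⟨hxy, le_rfl⟩
  have h4 := eVariationOn.edist_le u (s := Ici y) (x := y) (y := max y M)
    self_mem_Ici (mem_Ici.2 (le_max_left _ _))
  rw [hL _ (min_le_right _ _)] at h2
  rw [hR _ (le_max_right _ _)] at h4
  have h5 := ((add_le_add (add_le_add h2 h3) h4).trans h1).trans h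
  rw [edist_dist, edist_dist, edist_dist, ← ENNReal.ofReal_add dist_nonneg dist_nonneg,
    ← ENNReal.ofReal_add (by positivity) dist_nonneg,
    ENNReal.ofReal_le_ofReal_iff (sub_nonneg.2 hLR)] at h5
  simp only [Real.dist_eq] at h5
  have a1 := neg_abs_le (uL - u x)
  have a2 := neg_abs_le (u y - uR)
  have a3 := le_abs_self (u x - u y)
  linarith

/-- Monotone profiles are those whose variation equals the difference of the constant states, so
they stay monotone when the variation does not increase. -/
theorem Diminishing.monotone {a b : ℝ × List Particle}
    (h : Diminishing f I uL uR a b) (ha : State f I uL uR a.2)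
    (hmono : Monotone (interpolant f a.2)) : Monotone (interpolant f b.2) := by
  obtain ⟨M, hM⟩ := exists_pos_bound (a.2 ++ b.2)
  have h1 : ∀ r ∈ a.2, -M < r.pos ∧ r.pos < M := fun r hr => abs_lt.1 (hM r (by simp [hr]))
  have h2 : ∀ r ∈ b.2, -M < r.pos ∧ r.pos < M := fun r hr => abs_lt.1 (hM r (by simp [hr]))
  have hL : ∀ x ≤ -M, interpolant f a.2 x = uL := fun x hx =>
    ha.interpolant_left fun r hr => hx.trans_lt (h1 r hr).1
  have hR : ∀ x ≥ M, interpolant f a.2 x = uR := fun x hx =>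
    ha.interpolant_right fun r hr => (h1 r hr).2.le.trans hx
  have hmem : ∀ x, interpolant f a.2 x ∈ Icc uL uR := fun x =>
    ⟨by rw [← hL (min x (-M)) (min_le_right _ _)]; exact hmono (min_le_left _ _),
      by rw [← hR (max x M) (le_max_right _ _)]; exact hmono (le_max_left _ _)⟩
  exact monotone_of_eVariationOn_le
    (fun x hx => h.state.interpolant_left fun r hr => hx.trans_lt (h2 r hr).1)
    (fun x hx => h.state.interpolant_right fun r hr => (h2 r hr).2.le.trans hx)
    ((hmem 0).1.trans (hmem 0).2)
    (h.variation.trans (eVariationOn_le_of_monotone hmono hmem))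

theorem eVariationOn_neg (u : ℝ → ℝ) (s : Set ℝ) :
    eVariationOn (fun x => -u x) s = eVariationOn u s := by
  simp only [eVariationOn, edist_neg_neg]

theorem Diminishing.antitone {a b : ℝ × List Particle}
    (h : Diminishing f I uL uR a b) (ha : State f I uL uR a.2)
    (hanti : Antitone (interpolant f a.2)) : Antitone (interpolant f b.2) := by
  obtain ⟨M, hM⟩ := exists_pos_bound (a.2 ++ b.2)
  have h1 : ∀ r ∈ a.2, -M < r.pos ∧ r.pos < M := fun r hr => abs_lt.1 (hM r (by simp [hr]))
  have h2 : ∀ r ∈ b.2, -M < r.pos ∧ r.pos < M := fun r hr => abs_lt.1 (hM r (by simp [hr]))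
  have hmono : Monotone fun x => -interpolant f a.2 x := hanti.neg
  have hL : ∀ x ≤ -M, -interpolant f a.2 x = -uL := fun x hx => by
    rw [ha.interpolant_left fun r hr => hx.trans_lt (h1 r hr).1]
  have hR : ∀ x ≥ M, -interpolant f a.2 x = -uR := fun x hx => by
    rw [ha.interpolant_right fun r hr => (h1 r hr).2.le.trans hx]
  have hmem : ∀ x, -interpolant f a.2 x ∈ Icc (-uL) (-uR) := fun x =>
    ⟨by rw [← hL (min x (-M)) (min_le_right _ _)]; exact hmono (min_le_left _ _),
      by rw [← hR (max x M) (le_max_right _ _)]; exact hmono (le_max_left _ _)⟩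
  have hres : Monotone fun x => -interpolant f b.2 x := monotone_of_eVariationOn_le
    (fun x hx => by rw [h.state.interpolant_left fun r hr => hx.trans_lt (h2 r hr).1])
    (fun x hx => by rw [h.state.interpolant_right fun r hr => (h2 r hr).2.le.trans hx])
    ((hmem 0).1.trans (hmem 0).2)
    ((eVariationOn_neg _ _).trans_le (h.variation.trans
      ((eVariationOn_neg _ _).ge.trans (eVariationOn_le_of_monotone hmono hmem))))
  exact fun x y hxy => neg_le_neg_iff.1 (hres hxy)

end Merging

end ParticleMethod

/-! ### Characteristics within a phase of movement. -/

namespace ParticleMethod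

section Characteristics

variable {f η θ : ℝ → ℝ} {I : Set ℝ} {p q : Particle} {l c : List Particle} {x s : ℝ}

/-- Ordered lists of particles without jumps. -/
def Seamless (c : List Particle) : Prop :=
  c.Pairwise fun p q => p.pos ≤ q.pos ∧ (p.pos = q.pos → p.val = q.val)

theorem Seamless.tail (h : Seamless (p :: l)) : Seamless l := (List.pairwise_cons.1 h).2

theorem Seamless.head (h : Seamless (p :: q :: l)) :
    p.pos ≤ q.pos ∧ (p.pos = q.pos → p.val = q.val) := (List.pairwise_cons.1 h).1 q (by simp)

theorem Seamless.continuous (H : GenuinelyNonlinear f I) (hI : ∀ r ∈ c, r.val ∈ I)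
    (h : Seamless c) : Continuous (interpolant f c) := by
  induction c with
  | nil => exact continuous_const
  | cons p l ih =>
    cases l with
    | nil => exact continuous_const
    | cons q l =>
      have hpI := hI p (by simp)
      have hqI := hI q (by simp)
      obtain ⟨hle, heq⟩ := h.head
      rw [funext (interpolant_eq_add (f := f) (l := l) hle)]
      refine Continuous.add ?_
        ((ih (fun r hr => hI r (List.mem_cons_of_mem _ hr)) h.tail).sub continuous_const)
      rcases hle.eq_or_lt with hpq | hpq
      · have : interpolant f [p, q] = fun _ => q.val := funext fun x => by
          have := interpolant_pair_mem H hpI hqI x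
          rwa [heq hpq, uIcc_self, mem_singleton_iff] at this
        rw [this]
        exact continuous_const
      -- Clamping `x` to the gap reproduces the constant states on both sides.
      · have : interpolant f [p, q] = fun x => wave f p q (max p.pos (min q.pos x)) :=
          funext fun x => by
            rcases lt_or_ge x p.pos with h1 | h1
            · rw [interpolant_of_lt h1, min_eq_right (h1.trans hpq).le, max_eq_left h1.le,
                H.wave_left hpI hqI hpq]
            rcases lt_or_ge x q.pos with h2 | h2
            · rw [interpolant_eq_wave h1 h2, min_eq_right h2.le, max_eq_right h1]
            · rw [interpolant_of_le hpq.le h2, min_eq_left h2, max_eq_right hpq.le,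
                H.wave_right hpI hqI hpq]
              rfl
        rw [this]
        exact (H.continuousOn_wave hpI hqI hpq).comp_continuous (by fun_prop)
          fun x => ⟨le_max_left _ _, max_le hpq.le (min_le_left _ _)⟩

/-- The fraction of the gap at which a value `v` sits depends on `f'` only, not on time, so this
point travels with speed `f'(v)`. The entropy to its left is a sum of widths times fixed averages
and changes by telescoping differences of `P`. -/
theorem characteristic_aux (H : GenuinelyNonlinear f I) (hE : IsEntropyPair f η θ)
    (hI : ∀ r ∈ p :: l, r.val ∈ I) (h : Seamless (p :: l)) (h' : Seamless (move f s (p :: l)))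
    (hx : p.pos ≤ x) {v : ℝ} (hv : interpolant f (p :: l) x = v) :
    p.pos + deriv f p.val * s ≤ x + deriv f v * s ∧
    interpolant f (move f s (p :: l)) (x + deriv f v * s) = v ∧
    (∫ y in (p.pos + deriv f p.val * s)..(x + deriv f v * s),
        η (interpolant f (move f s (p :: l)) y))
      - ∫ y in p.pos..x, η (interpolant f (p :: l) y)
      = s * (potential f η θ v - potential f η θ p.val) := by
  induction l generalizing p with
  | nil =>
    have : p.val = v := hv
    subst this
    refine ⟨by linarith, rfl, ?_⟩
    simp [move, interpolant]
  | cons q l ih =>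
    have hpI := hI p (by simp)
    have hqI := hI q (by simp)
    have hI' : ∀ r ∈ q :: l, r.val ∈ I := fun r hr => hI r (List.mem_cons_of_mem _ hr)
    have hle := h.head.1
    have hmove : move f s (p :: q :: l) = ⟨p.pos + deriv f p.val * s, p.val⟩
        :: ⟨q.pos + deriv f q.val * s, q.val⟩ :: move f s l := rfl
    set p' : Particle := ⟨p.pos + deriv f p.val * s, p.val⟩ with hp'
    set q' : Particle := ⟨q.pos + deriv f q.val * s, q.val⟩ with hq'
    have hmove' : move f s (q :: l) = q' :: move f s l := rfl
    rw [hmove] at h' ⊢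
    have hle' := h'.head.1
    have hp'pos : p.pos + deriv f p.val * s = p'.pos := rfl
    have hq'pos : q.pos + deriv f q.val * s = q'.pos := rfl
    rw [hp'pos]
    rcases lt_or_ge x q.pos with hxq | hxq
    · have hpq : p.pos < q.pos := hx.trans_lt hxq
      have hpq' : p'.pos < q'.pos := by
        -- If the gap closed at time `s`, the two values and hence the speeds would agree, and the
        -- gap would have been closed before.
        refine hle'.lt_of_ne fun heq => hpq.ne ?_
        have hval : p.val = q.val := h'.head.2 heq
        rw [← hp'pos, ← hq'pos, hval] at heq
        linarith
      have hxm : x ∈ Icc p.pos q.pos := ⟨hx, hxq.le⟩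
      rw [interpolant_eq_wave hx hxq] at hv
      obtain ⟨hw, he⟩ := H.wave_spec hpI hqI hpq hxm
      rw [hv] at hw he
      have d0 : 0 < q.pos - p.pos := sub_pos.2 hpq
      have d1 : 0 < q'.pos - p'.pos := sub_pos.2 hpq'
      have e1 : (x + deriv f v * s - p'.pos) * (q.pos - p.pos)
          = (x - p.pos) * (q'.pos - p'.pos) := by
        rw [← hp'pos, ← hq'pos]; linear_combination -s * he
      have hx1 : p'.pos ≤ x + deriv f v * s := by
        have : 0 ≤ (x + deriv f v * s - p'.pos) * (q.pos - p.pos) := by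
          rw [e1]; exact mul_nonneg (sub_nonneg.2 hx) d1.le
        linarith [nonneg_of_mul_nonneg_left this d0]
      have hx2 : x + deriv f v * s < q'.pos := by
        have : 0 < (q'.pos - (x + deriv f v * s)) * (q.pos - p.pos) := by
          have : (q'.pos - (x + deriv f v * s)) * (q.pos - p.pos)
            = (q.pos - x) * (q'.pos - p'.pos) := by linear_combination -e1
          rw [this]; exact mul_pos (sub_pos.2 hxq) d1
        linarith [pos_of_mul_pos_left this d0.le]
      have hxm' : x + deriv f v * s ∈ Icc p'.pos q'.pos := ⟨hx1, hx2.le⟩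
      have hv' : wave f p' q' (x + deriv f v * s) = v := by
        refine H.wave_eq (p := p') (q := q') hpI hqI hpq' hw ?_
        refine mul_right_cancel₀ d0.ne' ?_
        linear_combination (deriv f q'.val - deriv f p'.val) * e1 + (q'.pos - p'.pos) * he
      refine ⟨hx1, by rw [interpolant_eq_wave hx1 hx2, hv'], ?_⟩
      have i1 : ∫ y in p.pos..x, η (interpolant f (p :: q :: l) y)
          = (x - p.pos) * waveAverage f η θ p.val v := by
        rw [← hv, ← H.integral_wave hE hpI hqI hpq hxm]
        refine intervalIntegral.integral_congr_uIoo fun y hy => ?_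
        rw [uIoo_of_le hx] at hy
        simp only [interpolant_eq_wave (f := f) (l := l) hy.1.le (hy.2.trans hxq)]
      have i2 : ∫ y in p'.pos..(x + deriv f v * s), η (interpolant f (p' :: q' :: move f s l) y)
          = (x + deriv f v * s - p'.pos) * waveAverage f η θ p.val v := by
        have := H.integral_wave (p := p') (q := q') hE hpI hqI hpq' hxm'
        rw [hv'] at this
        rw [← this]
        refine intervalIntegral.integral_congr_uIoo fun y hy => ?_
        rw [uIoo_of_le hx1] at hy
        simp only [interpolant_eq_wave (f := f) (l := move f s l) hy.1.le (hy.2.trans hx2)]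
      rw [i1, i2, ← H.waveAverage_mul η θ hpI (H.uIcc_subset hpI hqI hw), ← hp'pos]
      ring
    · rw [interpolant_of_le hle hxq] at hv
      obtain ⟨hx1, hx2, hx3⟩ := ih hI' h.tail h'.tail hxq hv
      rw [hmove'] at hx2 hx3
      rw [hq'pos] at hx1 hx3
      refine ⟨hle'.trans hx1, by rw [interpolant_of_le hle' hx1, hx2], ?_⟩
      have hc : Continuous fun y => η (interpolant f (p :: q :: l) y) :=
        hE.continuous.comp (h.continuous H hI)
      have hc' : Continuous fun y => η (interpolant f (p' :: q' :: move f s l) y) :=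
        hE.continuous.comp (h'.continuous H (by
          rw [← hmove]; exact forall_mem_move.2 hI))
      rw [← intervalIntegral.integral_add_adjacent_intervals (hc.intervalIntegrable p.pos q.pos)
          (hc.intervalIntegrable q.pos x),
        ← intervalIntegral.integral_add_adjacent_intervals (hc'.intervalIntegrable p'.pos q'.pos)
          (hc'.intervalIntegrable q'.pos _),
        (integral_interpolant_gap H hE hpI hqI hle).2,
        (integral_interpolant_gap H hE (p := p') (q := q') hpI hqI hle').2]
      have j1 : ∫ y in q.pos..x, η (interpolant f (p :: q :: l) y)
          = ∫ y in q.pos..x, η (interpolant f (q :: l) y) :=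
        intervalIntegral.integral_congr_uIoo fun y hy => by
          rw [uIoo_of_le hxq] at hy
          simp only [interpolant_of_le (f := f) (l := l) hle hy.1.le]
      have j2 : ∫ y in q'.pos..(x + deriv f v * s), η (interpolant f (p' :: q' :: move f s l) y)
          = ∫ y in q'.pos..(x + deriv f v * s), η (interpolant f (q' :: move f s l) y) :=
        intervalIntegral.integral_congr_uIoo fun y hy => by
          rw [uIoo_of_le hx1] at hy
          simp only [interpolant_of_le (f := f) (l := move f s l) hle' hy.1.le]
      rw [j1, j2]
      have hA := H.waveAverage_mul η θ hpI hqI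
      have hA' : waveAverage f η θ p'.val q'.val = waveAverage f η θ p.val q.val := rfl
      rw [hA', ← hp'pos, ← hq'pos] at *
      linear_combination hx3 + s * hA

/-- Values travel along characteristics, and the entropy between two characteristics changes
according to the entropy potential. -/
theorem characteristic (H : GenuinelyNonlinear f I) (hE : IsEntropyPair f η θ)
    (hI : ∀ r ∈ p :: l, r.val ∈ I) (h : Seamless (p :: l)) (h' : Seamless (move f s (p :: l)))
    (x : ℝ) {v : ℝ} (hv : interpolant f (p :: l) x = v) :
    interpolant f (move f s (p :: l)) (x + deriv f v * s) = v ∧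
    (∫ y in (p.pos + deriv f p.val * s)..(x + deriv f v * s),
        η (interpolant f (move f s (p :: l)) y))
      - ∫ y in p.pos..x, η (interpolant f (p :: l) y)
      = s * (potential f η θ v - potential f η θ p.val) := by
  rcases le_or_gt p.pos x with hx | hx
  · exact (characteristic_aux H hE hI h h' hx hv).2
  · rw [interpolant_of_lt hx] at hv
    subst hv
    have hmove : move f s (p :: l) = ⟨p.pos + deriv f p.val * s, p.val⟩ :: move f s l := rfl
    have hx' : x + deriv f p.val * s < p.pos + deriv f p.val * s := by linarith
    rw [hmove]
    refine ⟨interpolant_of_lt hx', ?_⟩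
    have i1 : ∫ y in p.pos..x, η (interpolant f (p :: l) y) = ∫ y in p.pos..x, η p.val :=
      intervalIntegral.integral_congr_uIoo fun y hy => by
        rw [uIoo_of_ge hx.le] at hy
        simp only [interpolant_of_lt (f := f) (l := l) hy.2]
    have i2 : ∫ y in (p.pos + deriv f p.val * s)..(x + deriv f p.val * s),
        η (interpolant f (⟨p.pos + deriv f p.val * s, p.val⟩ :: move f s l) y)
        = ∫ y in (p.pos + deriv f p.val * s)..(x + deriv f p.val * s), η p.val :=
      intervalIntegral.integral_congr_uIoo fun y hy => by
        rw [uIoo_of_ge hx'.le] at hy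
        simp only [interpolant_of_lt (f := f) (l := move f s l)
          (p := ⟨p.pos + deriv f p.val * s, p.val⟩) hy.2]
    rw [i1, i2]
    simp

/-- A meeting at an interior time with unequal speeds would violate the order at `T` if the left
particle is faster, and at `0` if it is slower. Equal speeds mean equal values. -/
theorem seamless_move (H : GenuinelyNonlinear f I) (hI : ∀ r ∈ c, r.val ∈ I) {T : ℝ}
    (h0 : Ordered c) (hT : Ordered (move f T c)) (hs : s ∈ Ioo 0 T) : Seamless (move f s c) := by
  refine List.pairwise_map.2 ((h0.and (List.pairwise_map.1 hT)).imp_of_mem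
    fun {p q} hp hq hpq => ?_)
  obtain ⟨h1, h2⟩ := hpq
  obtain ⟨hs0, hsT⟩ := hs
  simp only at h1 h2 ⊢
  constructor
  · nlinarith
  · intro heq
    refine H.injOn (hI p hp) (hI q hq) (le_antisymm ?_ ?_)
    · by_contra! hlt
      nlinarith
    · by_contra! hlt
      nlinarith

end Characteristics

end ParticleMethod

/-! ### From characteristics to the distributional entropy condition. -/

namespace ParticleMethod

section WeakForm

theorem integrable_mul_of_tsupport_subset {U : Set (ℝ × ℝ)} (hU : IsOpen U) {A ψ : ℝ × ℝ → ℝ}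
    (hA : ContinuousOn A U) (hψ : Continuous ψ) (hc : HasCompactSupport ψ) (hs : tsupport ψ ⊆ U) :
    Integrable fun z => A z * ψ z := by
  refine Continuous.integrable_of_hasCompactSupport ?_ hc.mul_left
  refine continuous_of_tsupport fun z hz => ?_
  have hzU : z ∈ U := hs (tsupport_mul_subset_right hz)
  exact (hA.continuousAt (hU.mem_nhds hzU)).mul hψ.continuousAt

theorem integral_mul_fderiv_of_tsupport_subset {U : Set (ℝ × ℝ)} (hU : IsOpen U)
    {A A' ψ : ℝ × ℝ → ℝ} {v : ℝ × ℝ} (hA : ContinuousOn A U) (hA' : ContinuousOn A' U)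
    (hd : ∀ z ∈ U, HasLineDerivAt ℝ A (A' z) z v) (hψ : ContDiff ℝ 1 ψ)
    (hc : HasCompactSupport ψ) (hs : tsupport ψ ⊆ U) :
    ∫ z, A z * fderiv ℝ ψ z v = -∫ z, A' z * ψ z := by
  have hcont : Continuous fun z => fderiv ℝ ψ z v :=
    (hψ.continuous_fderiv one_ne_zero).clm_apply continuous_const
  have hsub : tsupport (fun z => fderiv ℝ ψ z v) ⊆ tsupport ψ := tsupport_fderiv_apply_subset ℝ v
  exact integral_bilinear_hasLineDerivAt_right_eq_neg_left_of_integrable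
    (B := ContinuousLinearMap.mul ℝ ℝ)
    (integrable_mul_of_tsupport_subset hU hA' hψ.continuous hc hs)
    (integrable_mul_of_tsupport_subset hU hA hcont (hc.fderiv_apply ℝ v) (hsub.trans hs))
    (integrable_mul_of_tsupport_subset hU hA hψ.continuous hc hs)
    (fun z hz => hd z (hs hz))
    (fun z _ => ((hψ.differentiable (by norm_num)) z).hasFDerivAt.hasLineDerivAt v)

/-- If `η(u)` and `-q(u)` are the partial derivatives of a function in a strip, then the entropy
inequality holds in that strip, with equality. -/
theorem entropyInequality_of_hasDerivAt {η q : ℝ → ℝ} {a b : ℝ} {u Φ : ℝ → ℝ → ℝ}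
    (hη : ContinuousOn (fun z : ℝ × ℝ => η (u z.1 z.2)) (Ioo a b ×ˢ univ))
    (hq : ContinuousOn (fun z : ℝ × ℝ => q (u z.1 z.2)) (Ioo a b ×ˢ univ))
    (hΦ : ContinuousOn (fun z : ℝ × ℝ => Φ z.1 z.2) (Ioo a b ×ˢ univ))
    (hx : ∀ s ∈ Ioo a b, ∀ x, HasDerivAt (Φ s) (η (u s x)) x)
    (ht : ∀ s ∈ Ioo a b, ∀ x, HasDerivAt (fun t => Φ t x) (-q (u s x)) s) :
    EntropyInequality η q a b u := by
  intro φ hφ hc hs _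
  have hU : IsOpen (Ioo a b ×ˢ (univ : Set ℝ)) := isOpen_Ioo.prod isOpen_univ
  have hsmooth : ∀ v : ℝ × ℝ, ContDiff ℝ 1 fun z => fderiv ℝ φ z v := fun v =>
    (hφ.fderiv_right (m := 1) (by norm_cast)).clm_apply contDiff_const
  have hsupp : ∀ v : ℝ × ℝ, tsupport (fun z => fderiv ℝ φ z v) ⊆ Ioo a b ×ˢ univ := fun v =>
    (tsupport_fderiv_apply_subset ℝ v).trans hs
  have hcomp : ∀ v : ℝ × ℝ, HasCompactSupport fun z => fderiv ℝ φ z v := fun v =>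
    hc.fderiv_apply ℝ v
  have i1 := integrable_mul_of_tsupport_subset hU hη (hsmooth (1, 0)).continuous (hcomp _)
    (hsupp _)
  have i2 := integrable_mul_of_tsupport_subset hU hq (hsmooth (0, 1)).continuous (hcomp _)
    (hsupp _)
  have e1 := integral_mul_fderiv_of_tsupport_subset hU hΦ hη (v := (0, 1)) (fun z hz => by
    have := hx z.1 hz.1 z.2
    rw [← add_zero z.2] at this
    simpa [HasLineDerivAt] using this.comp_const_add) (hsmooth (1, 0)) (hcomp _) (hsupp _)
  have e2 := integral_mul_fderiv_of_tsupport_subset hU hΦ hq.neg (v := (1, 0)) (fun z hz => by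
    have := ht z.1 hz.1 z.2
    have h2 : HasDerivAt (fun t => Φ t z.2) (-q (u z.1 z.2)) (z.1 + 0) := by rwa [add_zero]
    simpa [HasLineDerivAt] using h2.comp_const_add) (hsmooth (0, 1)) (hcomp _) (hsupp _)
  -- Moving the derivatives off `Φ` turns the two terms into integrals of `Φ` against the two mixed
  -- second derivatives of `φ`, which cancel.
  have hsymm : ∀ z, fderiv ℝ (fun z => fderiv ℝ φ z (1, 0)) z (0, 1)
      = fderiv ℝ (fun z => fderiv ℝ φ z (0, 1)) z (1, 0) := fun z => by
    have hd : DifferentiableAt ℝ (fderiv ℝ φ) z :=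
      (hφ.fderiv_right (m := 1) (by norm_cast)).differentiable (by norm_num) z
    rw [fderiv_clm_apply hd (by fun_prop), fderiv_clm_apply hd (by fun_prop)]
    have := (hφ.contDiffAt (x := z)).isSymmSndFDerivAt (by
      rw [minSmoothness_of_isRCLikeNormedField]; norm_cast)
    simpa using this (0, 1) (1, 0)
  refine ⟨i1.add i2, le_of_eq ?_⟩
  rw [integral_add i1 i2]
  simp only [hsymm] at e1
  have e3 := e1.symm.trans e2
  simp only [Pi.neg_apply, neg_mul, integral_neg, neg_neg] at e3
  linarith

/-- A continuous function that is constant along characteristics, together with a primitive of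
`η(u)` in space that changes along characteristics according to the entropy potential, satisfies
the entropy condition. -/
theorem entropyInequality_of_characteristic {f η q : ℝ → ℝ} {a b K B : ℝ} {u Φ : ℝ → ℝ → ℝ}
    (hη : Continuous η) (hq : Continuous q)
    (hu : ∀ s ∈ Ioo a b, Continuous (u s))
    (hchar : ∀ s ∈ Ioo a b, ∀ t ∈ Ioo a b, ∀ x, u t (x + deriv f (u s x) * (t - s)) = u s x)
    (hΦ : ∀ s ∈ Ioo a b, ∀ x y, Φ s y - Φ s x = ∫ z in x..y, η (u s z))
    (hΦchar : ∀ s ∈ Ioo a b, ∀ t ∈ Ioo a b, ∀ x,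
      Φ t (x + deriv f (u s x) * (t - s)) - Φ s x = (t - s) * potential f η q (u s x))
    (hK : ∀ s x, |deriv f (u s x)| ≤ K) (hB : ∀ s x, |η (u s x)| ≤ B) :
    EntropyInequality η q a b u := by
  have hU : IsOpen (Ioo a b ×ˢ (univ : Set ℝ)) := isOpen_Ioo.prod isOpen_univ
  -- Tracing the characteristic through `z` to the fixed time `s` reduces joint continuity to
  -- continuity of `u s`; speeds are bounded by `K`, so its position at time `s` tends to `x`.
  have hcont : ContinuousOn (fun z : ℝ × ℝ => u z.1 z.2) (Ioo a b ×ˢ univ) := by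
    refine fun ⟨s, x⟩ hz => ContinuousAt.continuousWithinAt ?_
    have hs : s ∈ Ioo a b := hz.1
    have hlim : Filter.Tendsto (fun z : ℝ × ℝ => z.2 + deriv f (u z.1 z.2) * (s - z.1))
        (nhds (s, x)) (nhds x) := by
      rw [tendsto_iff_dist_tendsto_zero]
      have h0 : Filter.Tendsto (fun z : ℝ × ℝ => |z.2 - x| + K * |s - z.1|)
          (nhds (s, x)) (nhds 0) := by
        have : ContinuousAt (fun z : ℝ × ℝ => |z.2 - x| + K * |s - z.1|) (s, x) := by fun_prop
        simpa [ContinuousAt] using this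
      refine squeeze_zero (fun _ => dist_nonneg) (fun z => ?_) h0
      rw [Real.dist_eq, show z.2 + deriv f (u z.1 z.2) * (s - z.1) - x
        = (z.2 - x) + deriv f (u z.1 z.2) * (s - z.1) by ring]
      refine (abs_add_le _ _).trans ?_
      rw [abs_mul]
      gcongr
      exact hK _ _
    have h1 : Filter.Tendsto
        (fun z : ℝ × ℝ => u s (z.2 + deriv f (u z.1 z.2) * (s - z.1)))
        (nhds (s, x)) (nhds (u s x)) := ((hu s hs).tendsto x).comp hlim
    refine h1.congr' ?_
    filter_upwards [hU.mem_nhds hz] with z hz'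
    exact hchar z.1 hz'.1 s hs z.2
  have hηu := hη.comp_continuousOn hcont
  have hΦcont : ContinuousOn (fun z : ℝ × ℝ => Φ z.1 z.2) (Ioo a b ×ˢ univ) := by
    refine fun ⟨s, x⟩ hz => ContinuousAt.continuousWithinAt ?_
    have hs : s ∈ Ioo a b := hz.1
    set v := u s x with hv
    have h0 : Filter.Tendsto (fun z : ℝ × ℝ => |z.1 - s| * |potential f η q v|
        + B * |x + deriv f v * (z.1 - s) - z.2|) (nhds (s, x)) (nhds 0) := by
      have : ContinuousAt (fun z : ℝ × ℝ => |z.1 - s| * |potential f η q v|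
        + B * |x + deriv f v * (z.1 - s) - z.2|) (s, x) := by fun_prop
      simpa [ContinuousAt] using this
    rw [ContinuousAt, tendsto_iff_dist_tendsto_zero]
    refine squeeze_zero' (Filter.Eventually.of_forall fun _ => dist_nonneg) ?_ h0
    filter_upwards [hU.mem_nhds hz] with z hz'
    have c1 := hΦchar s hs z.1 hz'.1 x
    have c2 := hΦ z.1 hz'.1 z.2 (x + deriv f v * (z.1 - s))
    have c3 := intervalIntegral.norm_integral_le_of_norm_le_const (a := z.2)
      (b := x + deriv f v * (z.1 - s)) (f := fun y => η (u z.1 y)) (C := B)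
      fun y _ => hB z.1 y
    rw [Real.norm_eq_abs] at c3
    rw [← hv] at c1
    rw [Real.dist_eq, show Φ z.1 z.2 - Φ s x = (z.1 - s) * potential f η q v
      + -∫ y in z.2..(x + deriv f v * (z.1 - s)), η (u z.1 y) by linarith]
    refine (abs_add_le _ _).trans ?_
    rw [abs_mul, abs_neg]
    gcongr
  refine entropyInequality_of_hasDerivAt hηu (hq.comp_continuousOn hcont) hΦcont
    (fun s hs x => ?_) (fun s hs x => ?_)
  · have h1 : Φ s = fun y => Φ s 0 + ∫ z in (0:ℝ)..y, η (u s z) :=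
      funext fun y => by rw [← hΦ s hs]; ring
    rw [h1]
    exact ((hη.comp (hu s hs)).integral_hasStrictDerivAt 0 x).hasDerivAt.const_add _
  -- The time derivative comes from a detour: along the characteristic `Φ` gains `(t - s) P(v)`, and
  -- the way back to `x` at time `t` costs about `(t - s) f'(v) η(v)`. The balance is `-(t - s)
  -- q(v)`.
  · set v := u s x with hv
    have hK0 : 0 ≤ K := (abs_nonneg _).trans (hK s x)
    rw [hasDerivAt_iff_isLittleO, Asymptotics.isLittleO_iff]
    intro ε hε
    have hat : ContinuousAt (fun z : ℝ × ℝ => η (u z.1 z.2)) (s, x) :=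
      hηu.continuousAt (hU.mem_nhds ⟨hs, mem_univ _⟩)
    obtain ⟨δ, hδ, hδε⟩ := Metric.continuousAt_iff.1 hat (ε / (K + 1)) (by positivity)
    -- The two bounds keep `(t, y)` within `δ` of `(s, x)` in time and, at speed at most `K`, in
    -- space; `K + 1` avoids division by zero.
    have hnear : ∀ᶠ t in nhds s, |t - s| < min δ (δ / (K + 1)) := by
      have : ContinuousAt (fun t : ℝ => |t - s|) s := by fun_prop
      have h2 : Filter.Tendsto (fun t : ℝ => |t - s|) (nhds s) (nhds 0) := by
        simpa [ContinuousAt] using this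
      exact h2.eventually_lt_const (by positivity)
    filter_upwards [hnear, isOpen_Ioo.mem_nhds hs] with t ht htI
    obtain ⟨ht1, ht2⟩ := lt_min_iff.1 ht
    rw [lt_div_iff₀ (by positivity)] at ht2
    have c1 := hΦchar s hs t htI x
    have c2 := hΦ t htI x (x + deriv f v * (t - s))
    rw [← hv] at c1
    have hint : IntervalIntegrable (fun y => η (u t y)) volume x (x + deriv f v * (t - s)) :=
      (hη.comp (hu t htI)).intervalIntegrable _ _
    have c3 := intervalIntegral.norm_integral_le_of_norm_le_const (a := x)
      (b := x + deriv f v * (t - s)) (f := fun y => η (u t y) - η v) (C := ε / (K + 1))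
      fun y hy => by
        have hy' : |y - x| ≤ K * |t - s| := by
          have h1 := abs_sub_left_of_mem_uIcc (uIoc_subset_uIcc hy)
          rw [add_sub_cancel_left, abs_mul] at h1
          exact h1.trans (mul_le_mul_of_nonneg_right (hK s x) (abs_nonneg _))
        have := @hδε (t, y) (by
          rw [Prod.dist_eq, Real.dist_eq, Real.dist_eq]
          refine max_lt ht1 (hy'.trans_lt ?_)
          nlinarith [abs_nonneg (t - s)])
        rw [Real.dist_eq] at this
        exact this.le
    rw [intervalIntegral.integral_sub hint intervalIntegrable_const,
      intervalIntegral.integral_const, smul_eq_mul, add_sub_cancel_left, abs_mul] at c3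
    rw [smul_eq_mul, show Φ t x - Φ s x - (t - s) * -q v
      = -((∫ y in x..(x + deriv f v * (t - s)), η (u t y)) - deriv f v * (t - s) * η v) by
        rw [potential] at c1; linarith, norm_neg, Real.norm_eq_abs (t - s)]
    refine c3.trans ?_
    calc ε / (K + 1) * (|deriv f v| * |t - s|) ≤ ε / (K + 1) * ((K + 1) * |t - s|) := by
          gcongr
          linarith [hK s x]
      _ = ε * |t - s| := by field_simp

end WeakForm

end ParticleMethod

/-! ### The entropy condition for a run, and the theorem. -/

namespace ParticleMethod

theorem Run.entropyInequality {f η q : ℝ → ℝ} {I : Set ℝ} (H : GenuinelyNonlinear f I)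
    (hE : IsEntropyPair f η q) (R : Run f I) (n : ℕ) :
    EntropyInequality η q (R.time n) (R.time (n + 1)) (R.solution n) := by
  have hle : R.time n ≤ R.time (n + 1) := R.time_mono (Nat.le_succ n)
  have hmem : ∀ r ∈ R.config n, r.val ∈ I := by
    have := (R.state H (n := n) (t := R.time n) ⟨le_rfl, hle⟩).mem
    simpa [particles, move_zero] using this
  have h0 : Ordered (R.config n) := by
    simpa [move_zero] using R.no_overtaking n (R.time n) ⟨le_rfl, hle⟩
  have hT := R.no_overtaking n (R.time (n + 1)) ⟨hle, le_rfl⟩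
  have hne : R.config n ≠ [] := by
    have := (R.state H (n := n) (t := R.time n) ⟨le_rfl, hle⟩).ne_nil
    simpa [particles, move_zero] using this
  have hseam : ∀ s ∈ Ioo (R.time n) (R.time (n + 1)),
      Seamless (move f (s - R.time n) (R.config n)) := fun s hs =>
    seamless_move H hmem h0 hT ⟨sub_pos.2 hs.1, sub_lt_sub_right hs.2 _⟩
  have hcont : ∀ s ∈ Ioo (R.time n) (R.time (n + 1)), Continuous (R.solution n s) := fun s hs =>
    (hseam s hs).continuous H (forall_mem_move.2 hmem)
  -- The values are entered as positions, so that the bound for positions yields a bound for values.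
  obtain ⟨M, hM⟩ := exists_pos_bound ((R.config n).map fun r => ⟨r.val, 0⟩)
  have hrange : ∀ s x, R.solution n s x ∈ Icc (-M) M := fun s x =>
    H.interpolant_mem (by simpa [move] using hne) (forall_mem_move.2 hmem)
      (forall_mem_move.2 fun r hr => abs_le.1 (hM ⟨r.val, 0⟩ (List.mem_map_of_mem hr)).le) x
  obtain ⟨K, hK⟩ := isCompact_Icc.exists_bound_of_continuousOn
    (H.continuous_deriv.continuousOn (s := Icc (-M) M))
  obtain ⟨B, hB⟩ := isCompact_Icc.exists_bound_of_continuousOn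
    (hE.continuous.continuousOn (s := Icc (-M) M))
  obtain ⟨p, l, hpl⟩ := List.exists_cons_of_ne_nil hne
  have hchar : ∀ s ∈ Ioo (R.time n) (R.time (n + 1)), ∀ t ∈ Ioo (R.time n) (R.time (n + 1)), ∀ x,
      R.solution n t (x + deriv f (R.solution n s x) * (t - s)) = R.solution n s x ∧
      (∫ y in (p.pos + deriv f p.val * (t - R.time n))..
          (x + deriv f (R.solution n s x) * (t - s)), η (R.solution n t y))
        - ∫ y in (p.pos + deriv f p.val * (s - R.time n))..x, η (R.solution n s y)
        = (t - s) * (potential f η q (R.solution n s x) - potential f η q p.val) := by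
    intro s hs t ht x
    have hmm : move f (t - s) (move f (s - R.time n) (R.config n))
        = move f (t - R.time n) (R.config n) := by
      rw [move_move]; congr 1; ring
    have hcons : move f (s - R.time n) (R.config n)
        = ⟨p.pos + deriv f p.val * (s - R.time n), p.val⟩ :: move f (s - R.time n) l := by
      rw [hpl]; rfl
    have hss := hseam s hs
    have htt := hseam t ht
    have hms := (forall_mem_move (f := f) (s := s - R.time n) (P := (· ∈ I))).2 hmem
    have hsol : R.solution n t
        = interpolant f (move f (t - s) (move f (s - R.time n) (R.config n))) := by rw [hmm]; rfl
    have hsols : R.solution n s = interpolant f (move f (s - R.time n) (R.config n)) := rfl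
    rw [← hmm] at htt
    rw [hcons] at hss htt hms hsol hsols
    have := characteristic H hE hms hss htt x rfl
    rw [← hsol, ← hsols] at this
    refine ⟨this.1, ?_⟩
    rw [← this.2]
    congr 2
    ring
  -- `Φ` is the entropy to the right of the first particle's path. The term `t P(p.val)` compensates
  -- for the motion of this base point, so that along each characteristic `Φ` changes by the
  -- potential of its own value alone.
  refine entropyInequality_of_characteristic (f := f) (K := K) (B := B)
    (Φ := fun t x => (∫ y in (p.pos + deriv f p.val * (t - R.time n))..x, η (R.solution n t y))
      + t * potential f η q p.val)
    hE.continuous (hE.continuous_flux H) hcont (fun s hs t ht x => (hchar s hs t ht x).1)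
    (fun s hs x y => ?_) (fun s hs t ht x => ?_) (fun s x => hK _ (hrange s x))
    (fun s x => hB _ (hrange s x))
  · have hc : Continuous fun y => η (R.solution n s y) := hE.continuous.comp (hcont s hs)
    rw [add_sub_add_right_eq_sub, intervalIntegral.integral_interval_sub_left
      (hc.intervalIntegrable _ _) (hc.intervalIntegrable _ _)]
  · linear_combination (hchar s hs t ht x).2

end ParticleMethod

theorem mainTheorem2 (f : ℝ → ℝ) (I : Set ℝ) (hf : ContDiff ℝ 1 f)
    (hI : StrictConvexOn ℝ I f ∨ StrictConcaveOn ℝ I f) (R : ParticleMethod.Run f I) :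
    -- the total variation is finite and does not increase
    (∀ n s m t, R.Before n s m t →
      R.totalVariation n s ≠ ⊤ ∧ R.totalVariation m t ≤ R.totalVariation n s) ∧
    -- the entropy condition holds in the sense of distributions during particle movement
    (∀ η q, ParticleMethod.IsEntropyPair f η q → ∀ n,
      ParticleMethod.EntropyInequality η q (R.time n) (R.time (n + 1)) (R.solution n)) ∧
    -- the entropy condition holds, integrated in space, across movement and management
    (∀ η q, ParticleMethod.IsEntropyPair f η q → ∀ n s m t, R.Before n s m t →
      Integrable (fun x => η (R.solution m t x) - η (R.solution n s x)) ∧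
      (∫ x, (η (R.solution m t x) - η (R.solution n s x)))
        + (t - s) * (q R.rightState - q R.leftState) ≤ 0) ∧
    -- no spurious oscillations: no values outside the former range, and monotone profiles stay monotone
    (∀ n s m t, R.Before n s m t →
      (∀ a b, (∀ x, R.solution n s x ∈ Icc a b) → ∀ x, R.solution m t x ∈ Icc a b) ∧
      (Monotone (R.solution n s) → Monotone (R.solution m t)) ∧
      (Antitone (R.solution n s) → Antitone (R.solution m t))) := by
  have H : ParticleMethod.GenuinelyNonlinear f I := ⟨hf, hI⟩
  refine ⟨fun n s m t h => ⟨?_, (R.diminishing H h).variation⟩,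
    fun η q hE n => R.entropyInequality H hE n, fun η q hE n s m t h => ?_,
    fun n s m t h => ⟨(R.diminishing H h).range, (R.diminishing H h).monotone (R.state H h.1),
      (R.diminishing H h).antitone (R.state H h.1)⟩⟩
  · exact ((R.state H h.1).toAdmissible.eVariationOn_interpolant H).trans_ne
      (ParticleMethod.valueVariation_ne_top _)
  · obtain ⟨hint, hval⟩ := (R.state H h.1).integral_sub H hE (R.diminishing H h).state
    refine ⟨hint, ?_⟩
    have hent := (R.diminishing H h).entropy η q hE
    have : ∫ x, (η (R.solution m t x) - η (R.solution n s x)) = _ := hval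
    rw [this]
    simp only at hent ⊢
    linarith
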